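/- Let $(A,\Delta)$ be a regular multiplier Hopf algebra over $\mathbb{C}$: $A$ is an associative algebra, with or without unit, whose product is non-degenerate; $\Delta:A\to M(A\otimes A)$ is a homomorphism into the multiplier algebra; $\Delta(a)(1\otimes b)$ and $(a\otimes 1)\Delta(b)$ lie in $A\otimes A$; $\Delta$ is coassociative; the linear maps $a\otimes b\mapsto\Delta(a)(1\otimes b)$ and $a\otimes b\mapsto(a\otimes 1)\Delta(b)$ are bijections of $A\otimes A$; and the same holds for $\Delta^{cop}=\sigma\Delta$, where $\sigma$ is the flip. Let $\varepsilon$ be its counit and $S:A\to A$ its (bijective) antipode. Homomorphisms and anti-homomorphisms such as $\Delta\otimes\iota$, $\varepsilon\otimes\iota$, $S$, $S^{-1}$, $S\otimes S$ are extended to multiplier algebras in the usual way. Let $R$ be a generalized R-matrix for $A$, i.e. an invertible element of $M(A\otimes A)$ such that $R\Delta(a)=\Delta^{cop}(a)R$ for all $a\in A$, $(\Delta\otimes\iota)(R)=R^{13}R^{23}$, $(\iota\otimes\Delta)(R)=R^{13}R^{12}$, and $R(a\otimes 1),(a\otimes 1)R\in A\otimes M(A)$ for all $a\in A$. Write $R(a\otimes1)=\sum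 R^{(1)}a\otimes R^{(2)}$ and $(a\otimes1)R=\sum aR^{(1)}\otimes R^{(2)}$ in $A\otimes M(A)$. Then: 1. $(\varepsilon\otimes\iota)(R)=1=(\iota\otimes\varepsilon)(R)$ in $M(A)$. 2. For all $a\in A$, $$R^{-1}(a\otimes1)=(\iota\otimes S^{-1})(R(a\otimes1)),\qquad (a\otimes1)R^{-1}=(\iota\otimes S^{-1})((a\otimes1)R),$$ $$R^{-1}(a\otimes1)=(S\otimes\iota)((S^{-1}(a)\otimes1)R),\qquad (a\otimes1)R^{-1}=(S\otimes\iota)(R(S^{-1}(a)\otimes1)).$$ 3. $(S\otimes S)(R)=R$ in $M(A\otimes A)$. 4. There is an invertible multiplier $u\in M(A)$ with $ua=\sum S(R^{(2)})R^{(1)}a$ for all $a\in A$, and its inverse satisfies, for all $a\in A$, $$u^{-1}a=\sum S^{-2}(R^{(2)})R^{(1)}a=\sum S^{-1}(R^{(2)})S(R^{(1)})a=\sum R^{(2)}S^2(R^{(1)})a.$$ Here $\sum S^{-1}(R^{(2)})S(R^{(1)})a$ is the image of $(S^{-1}(a)\otimes 1)R$ under $x\otimes m\mapsto S^{-1}(m)S(x)$,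 and $\sum R^{(2)}S^2(R^{(1)})a$ is the image of $R(S^{-2}(a)\otimes 1)$ under $x\otimes m\mapsto m\,S^2(x)$, both maps from $A\otimes M(A)$ to $A$. -/

import Mathlib

open scoped TensorProduct

set_option linter.unusedSectionVars false

noncomputable section

namespace MultHopf

/-! ## Multiplier algebras -/

section Multiplier

variable {A : Type*} [NonUnitalRing A] [Module ℂ A] [IsScalarTower ℂ A A] [SMulCommClass ℂ A A]
variable {B : Type*} [NonUnitalRing B] [Module ℂ B] [IsScalarTower ℂ B B] [SMulCommClass ℂ B B]

/-- The product of `A` is non-degenerate (as a bilinear form). -/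
structure Nondegenerate (A : Type*) [NonUnitalRing A] : Prop where
  left : ∀ a : A, (∀ b : A, a * b = 0) → a = 0
  right : ∀ a : A, (∀ b : A, b * a = 0) → a = 0

variable (A) in
/-- The multiplier algebra `M(A)`: pairs `(L, R)` of linear maps on `A` (left multiplication
`b ↦ m b` and right multiplication `a ↦ a m`) such that `a * L b = R a * b`.
The product is `(L, R) (L', R') = (L ∘ L', R' ∘ R)` and the unit is `(id, id)`. -/
def multiplierSubalgebra : Subalgebra ℂ (Module.End ℂ A × (Module.End ℂ A)ᵐᵒᵖ) where
  carrier := {m | ∀ a b : A, a * m.1 b = m.2.unop a * b}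
  mul_mem' {x y} hx hy := by
    intro a b
    have h1 := hx a (y.1 b)
    have h2 := hy (x.2.unop a) b
    simpa using h1.trans h2
  add_mem' {x y} hx hy := by
    intro a b
    simp [mul_add, add_mul, hx a b, hy a b]
  algebraMap_mem' r := by
    intro a b
    exact (mul_smul_comm r a b).trans (smul_mul_assoc r a b).symm

variable (A) in
/-- The type of elements of the multiplier algebra `M(A)`. -/
def M : Type _ := multiplierSubalgebra A

instance : Ring (M A) := inferInstanceAs (Ring (multiplierSubalgebra A))

instance : Algebra ℂ (M A) := inferInstanceAs (Algebra ℂ (multiplierSubalgebra A))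

/-- `lmul m b` is the element `m b` of `A`. -/
def lmul (m : M A) : A →ₗ[ℂ] A := m.1.1

/-- `rmul m a` is the element `a m` of `A`. -/
def rmul (m : M A) : A →ₗ[ℂ] A := m.1.2.unop

/-- The multiplier with given left and right multiplication maps. -/
def mk (l r : A →ₗ[ℂ] A) (h : ∀ a b, a * l b = r a * b) : M A := ⟨(l, MulOpposite.op r), h⟩

@[simp] lemma lmul_mk (l r : A →ₗ[ℂ] A) (h : ∀ a b, a * l b = r a * b) : lmul (mk l r h) = l := rfl
@[simp] lemma rmul_mk (l r : A →ₗ[ℂ] A) (h : ∀ a b, a * l b = r a * b) : rmul (mk l r h) = r := rfl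

lemma mul_lmul (m : M A) (a b : A) : a * lmul m b = rmul m a * b := m.2 a b

lemma ext_M {m n : M A} (h1 : ∀ a, lmul m a = lmul n a) (h2 : ∀ a, rmul m a = rmul n a) :
    m = n := by
  apply Subtype.ext
  refine Prod.ext (LinearMap.ext h1) ?_
  apply MulOpposite.unop_injective
  exact LinearMap.ext h2

@[simp] lemma lmul_mul (m n : M A) (a : A) : lmul (m * n) a = lmul m (lmul n a) := rfl
@[simp] lemma rmul_mul (m n : M A) (a : A) : rmul (m * n) a = rmul n (rmul m a) := rfl
@[simp] lemma lmul_one (a : A) : lmul (1 : M A) a = a := rfl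
@[simp] lemma rmul_one (a : A) : rmul (1 : M A) a = a := rfl
@[simp] lemma lmul_add (m n : M A) (a : A) : lmul (m + n) a = lmul m a + lmul n a := rfl
@[simp] lemma rmul_add (m n : M A) (a : A) : rmul (m + n) a = rmul m a + rmul n a := rfl
@[simp] lemma lmul_smul (c : ℂ) (m : M A) (a : A) : lmul (c • m) a = c • lmul m a := rfl
@[simp] lemma rmul_smul (c : ℂ) (m : M A) (a : A) : rmul (c • m) a = c • rmul m a := rfl

variable (A) in
/-- The canonical map `A → M(A)`. -/
def inc : A →ₗ[ℂ] M A where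
  toFun a := mk (LinearMap.mulLeft ℂ a) (LinearMap.mulRight ℂ a) (by intro x y; simp [mul_assoc])
  map_add' a b := ext_M (fun x => add_mul a b x) (fun x => mul_add x a b)
  map_smul' c a := ext_M (fun x => smul_mul_assoc c a x) (fun x => mul_smul_comm c x a)

@[simp] lemma lmul_inc (a b : A) : lmul (inc A a) b = a * b := rfl
@[simp] lemma rmul_inc (a b : A) : rmul (inc A a) b = b * a := rfl

/-- The canonical map `M(A) ⊗ M(B) → M(A ⊗ B)`, where `m ⊗ n` acts leg by leg. -/
def tens : M A ⊗[ℂ] M B →ₗ[ℂ] M (A ⊗[ℂ] B) :=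
  TensorProduct.lift <| LinearMap.mk₂ ℂ
    (fun m n => mk (TensorProduct.map (lmul m) (lmul n)) (TensorProduct.map (rmul m) (rmul n)) (by
      intro x y
      induction x with
      | zero => simp
      | add x x' hx hx' => simp [add_mul, hx, hx']
      | tmul a b =>
        induction y with
        | zero => simp
        | add y y' hy hy' => simp only [map_add, mul_add, hy, hy']
        | tmul c d => simp [mul_lmul]))
    (by
      intro m m' n
      refine ext_M (fun x => ?_) (fun x => ?_) <;> induction x with
      | zero => simp
      | add x x' hx hx' => simp only [map_add, hx, hx']
      | tmul a b => simp [TensorProduct.add_tmul])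
    (by
      intro c m n
      refine ext_M (fun x => ?_) (fun x => ?_) <;> induction x with
      | zero => simp
      | add x x' hx hx' => simp only [map_add, hx, hx']
      | tmul a b => simp [TensorProduct.smul_tmul'])
    (by
      intro m n n'
      refine ext_M (fun x => ?_) (fun x => ?_) <;> induction x with
      | zero => simp
      | add x x' hx hx' => simp only [map_add, hx, hx']
      | tmul a b => simp [TensorProduct.tmul_add])
    (by
      intro c m n
      refine ext_M (fun x => ?_) (fun x => ?_) <;> induction x with
      | zero => simp
      | add x x' hx hx' => simp only [map_add, hx, hx']
      | tmul a b => simp)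

@[simp] lemma lmul_tens (m : M A) (n : M B) (x : A ⊗[ℂ] B) :
    lmul (tens (m ⊗ₜ n)) x = TensorProduct.map (lmul m) (lmul n) x := rfl
@[simp] lemma rmul_tens (m : M A) (n : M B) (x : A ⊗[ℂ] B) :
    rmul (tens (m ⊗ₜ n)) x = TensorProduct.map (rmul m) (rmul n) x := rfl

/-- `a ⊗ 1` as a multiplier of `A ⊗ B`. -/
def tmulOne (a : A) : M (A ⊗[ℂ] B) := tens (inc A a ⊗ₜ 1)

/-- `1 ⊗ b` as a multiplier of `A ⊗ B`. -/
def oneTmul (b : B) : M (A ⊗[ℂ] B) := tens (1 ⊗ₜ inc B b)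

/-- The inclusion `A ⊗ M(B) → M(A ⊗ B)`. -/
def emb : A ⊗[ℂ] M B →ₗ[ℂ] M (A ⊗[ℂ] B) := tens ∘ₗ TensorProduct.map (inc A) LinearMap.id

/-- Transport of multipliers along an algebra isomorphism `e`. -/
def transport (e : A ≃ₗ[ℂ] B) (he : ∀ x y, e (x * y) = e x * e y) : M A →ₗ[ℂ] M B where
  toFun m := mk (e.toLinearMap ∘ₗ lmul m ∘ₗ e.symm.toLinearMap)
    (e.toLinearMap ∘ₗ rmul m ∘ₗ e.symm.toLinearMap) (by
      intro a b
      have h := congrArg e (mul_lmul m (e.symm a) (e.symm b))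
      simpa [he] using h)
  map_add' m n := ext_M (by intro x; simp) (by intro x; simp)
  map_smul' c m := ext_M (by intro x; simp) (by intro x; simp)

/-- The extension to multipliers of an anti-automorphism `e` of `A`, given by
`e(m) e(a) = e(a m)` and `e(a) e(m) = e(m a)`. -/
def antiExt (e : A ≃ₗ[ℂ] A) (he : ∀ x y, e (x * y) = e y * e x) : M A →ₗ[ℂ] M A where
  toFun m := mk (e.toLinearMap ∘ₗ rmul m ∘ₗ e.symm.toLinearMap)
    (e.toLinearMap ∘ₗ lmul m ∘ₗ e.symm.toLinearMap) (by
      intro a b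
      have h := congrArg e (mul_lmul m (e.symm b) (e.symm a))
      simpa [he] using h.symm)
  map_add' m n := ext_M (by intro x; simp) (by intro x; simp)
  map_smul' c m := ext_M (by intro x; simp) (by intro x; simp)

/-- Let `φ : A → M(B)` be a non-degenerate homomorphism and `m ∈ M(A)`. `Extends φ m X` says that
`φ(m) = X`, where `φ(m)` is the value at `m` of the unique unital extension `M(A) → M(B)` of `φ`:
this is the multiplier determined by `φ(m) φ(a) = φ(m a)` and `φ(a) φ(m) = φ(a m)` for all `a`. -/
def Extends (φ : A →ₗ[ℂ] M B) (m : M A) (X : M B) : Prop :=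
  ∀ a : A, X * φ a = φ (lmul m a) ∧ φ a * X = φ (rmul m a)

lemma comm_mul (x y : A ⊗[ℂ] B) :
    TensorProduct.comm ℂ A B (x * y) = TensorProduct.comm ℂ A B x * TensorProduct.comm ℂ A B y := by
  induction x with
  | zero => simp
  | add x x' hx hx' => simp only [add_mul, map_add, hx, hx']
  | tmul a b =>
    induction y with
    | zero => simp
    | add y y' hy hy' => simp only [mul_add, map_add, hy, hy']
    | tmul c d => simp

lemma rightComm_mul (x y : (A ⊗[ℂ] A) ⊗[ℂ] A) :
    TensorProduct.rightComm ℂ A A A (x * y) =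
      TensorProduct.rightComm ℂ A A A x * TensorProduct.rightComm ℂ A A A y := by
  induction x with
  | zero => simp
  | add x x' hx hx' => simp only [add_mul, map_add, hx, hx']
  | tmul a b =>
    induction y with
    | zero => simp
    | add y y' hy hy' => simp only [mul_add, map_add, hy, hy']
    | tmul c d =>
      induction a with
      | zero => simp
      | add a a' ha ha' => simp only [TensorProduct.add_tmul, add_mul, map_add, ha, ha']
      | tmul a a' =>
        induction c with
        | zero => simp
        | add c c' hc hc' => simp only [TensorProduct.add_tmul, mul_add, map_add, hc, hc']
        | tmul c c' => simp

lemma assoc_symm_mul (x y : A ⊗[ℂ] (A ⊗[ℂ] A)) :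
    (TensorProduct.assoc ℂ A A A).symm (x * y) =
      (TensorProduct.assoc ℂ A A A).symm x * (TensorProduct.assoc ℂ A A A).symm y := by
  induction x with
  | zero => simp
  | add x x' hx hx' => simp only [add_mul, map_add, hx, hx']
  | tmul a b =>
    induction y with
    | zero => simp
    | add y y' hy hy' => simp only [mul_add, map_add, hy, hy']
    | tmul c d =>
      induction b with
      | zero => simp
      | add a a' ha ha' => simp only [TensorProduct.tmul_add, add_mul, map_add, ha, ha']
      | tmul a a' =>
        induction d with
        | zero => simp
        | add c c' hc hc' => simp only [TensorProduct.tmul_add, mul_add, map_add, hc, hc']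
        | tmul c c' => simp

/-- The flip on `M(A ⊗ A)`. -/
def flip : M (A ⊗[ℂ] A) →ₗ[ℂ] M (A ⊗[ℂ] A) := transport (TensorProduct.comm ℂ A A) comm_mul

/-- Leg numbering: `R¹² = R ⊗ 1`. -/
def leg12 (R : M (A ⊗[ℂ] A)) : M ((A ⊗[ℂ] A) ⊗[ℂ] A) := tens (R ⊗ₜ 1)

/-- Leg numbering: `R¹³`, obtained from `R ⊗ 1` by exchanging the last two legs. -/
def leg13 (R : M (A ⊗[ℂ] A)) : M ((A ⊗[ℂ] A) ⊗[ℂ] A) :=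
  transport (A := (A ⊗[ℂ] A) ⊗[ℂ] A) (B := (A ⊗[ℂ] A) ⊗[ℂ] A)
    (TensorProduct.rightComm ℂ A A A) rightComm_mul (leg12 R)

/-- Leg numbering: `R²³ = 1 ⊗ R`. -/
def leg23 (R : M (A ⊗[ℂ] A)) : M ((A ⊗[ℂ] A) ⊗[ℂ] A) :=
  transport (A := A ⊗[ℂ] (A ⊗[ℂ] A)) (B := (A ⊗[ℂ] A) ⊗[ℂ] A)
    (TensorProduct.assoc ℂ A A A).symm assoc_symm_mul (tens (1 ⊗ₜ R))

end Multiplier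

/-! ## Regular multiplier Hopf algebras -/

section Hopf

variable {A : Type*} [NonUnitalRing A] [Module ℂ A] [IsScalarTower ℂ A A] [SMulCommClass ℂ A A]

/-- `f ⊗ ι : A ⊗ A → A` for a linear functional `f` on `A`. -/
def sliceL (f : A →ₗ[ℂ] ℂ) : A ⊗[ℂ] A →ₗ[ℂ] A :=
  (TensorProduct.lid ℂ A).toLinearMap ∘ₗ f.rTensor A

/-- `ι ⊗ f : A ⊗ A → A` for a linear functional `f` on `A`. -/
def sliceR (f : A →ₗ[ℂ] ℂ) : A ⊗[ℂ] A →ₗ[ℂ] A :=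
  (TensorProduct.rid ℂ A).toLinearMap ∘ₗ f.lTensor A

@[simp] lemma sliceL_tmul (f : A →ₗ[ℂ] ℂ) (a b : A) : sliceL f (a ⊗ₜ b) = f a • b := by
  simp [sliceL]

@[simp] lemma sliceR_tmul (f : A →ₗ[ℂ] ℂ) (a b : A) : sliceR f (a ⊗ₜ b) = f b • a := by
  simp [sliceR]

/-- `(A, Δ)` is a multiplier Hopf algebra (`A` having a non-degenerate product):
`Δ : A → M(A ⊗ A)` is a homomorphism, `Δ(a)(1 ⊗ b)` and `(a ⊗ 1)Δ(b)` lie in `A ⊗ A`, the linear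
maps `T₁ (a ⊗ b) = Δ(a)(1 ⊗ b)` and `T₂ (a ⊗ b) = (a ⊗ 1)Δ(b)` are bijections of `A ⊗ A`, and `Δ` is
coassociative: `(a ⊗ 1 ⊗ 1)(Δ ⊗ ι)(Δ(b)(1 ⊗ c)) = (ι ⊗ Δ)((a ⊗ 1)Δ(b))(1 ⊗ 1 ⊗ c)`. -/
def IsMultiplierHopf (Δ : A →ₗ[ℂ] M (A ⊗[ℂ] A)) : Prop :=
  (∀ a b, Δ (a * b) = Δ a * Δ b) ∧
  ∃ T₁ T₂ : A ⊗[ℂ] A ≃ₗ[ℂ] A ⊗[ℂ] A,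
    (∀ a b, inc (A ⊗[ℂ] A) (T₁ (a ⊗ₜ b)) = Δ a * oneTmul b) ∧
    (∀ a b, inc (A ⊗[ℂ] A) (T₂ (a ⊗ₜ b)) = tmulOne a * Δ b) ∧
    ∀ a b c : A,
      TensorProduct.assoc ℂ A A A
          (T₂.toLinearMap.rTensor A ((TensorProduct.assoc ℂ A A A).symm (a ⊗ₜ T₁ (b ⊗ₜ c)))) =
        T₁.toLinearMap.lTensor A (TensorProduct.assoc ℂ A A A (T₂ (a ⊗ₜ b) ⊗ₜ c))

variable (A) in
/-- A regular multiplier Hopf algebra: a multiplier Hopf algebra `(A, Δ)` such that `(A, σΔ)`, with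
`σ` the flip, is a multiplier Hopf algebra as well. -/
structure RegularMultiplierHopfAlgebra where
  nondegenerate : Nondegenerate A
  Δ : A →ₗ[ℂ] M (A ⊗[ℂ] A)
  isMultiplierHopf : IsMultiplierHopf Δ
  isMultiplierHopf_flip : IsMultiplierHopf (flip ∘ₗ Δ)

/-- `ε` is a counit: a homomorphism `A → ℂ` with `(ε ⊗ ι)(Δ(a)(1 ⊗ b)) = ab` and
`(ι ⊗ ε)((a ⊗ 1)Δ(b)) = ab`. -/
structure IsCounit (Δ : A →ₗ[ℂ] M (A ⊗[ℂ] A)) (ε : A →ₗ[ℂ] ℂ) : Prop where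
  map_mul : ∀ a b, ε (a * b) = ε a * ε b
  left : ∀ a b x, inc (A ⊗[ℂ] A) x = Δ a * oneTmul b → sliceL ε x = a * b
  right : ∀ a b x, inc (A ⊗[ℂ] A) x = tmulOne a * Δ b → sliceR ε x = a * b

/-- `S` is an antipode: an anti-homomorphism with `m(S ⊗ ι)(Δ(a)(1 ⊗ b)) = ε(a)b` and
`m(ι ⊗ S)((a ⊗ 1)Δ(b)) = ε(b)a`. -/
structure IsAntipode (Δ : A →ₗ[ℂ] M (A ⊗[ℂ] A)) (ε : A →ₗ[ℂ] ℂ) (S : A →ₗ[ℂ] A) : Prop where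
  map_mul : ∀ a b, S (a * b) = S b * S a
  left : ∀ a b x, inc (A ⊗[ℂ] A) x = Δ a * oneTmul b →
    LinearMap.mul' ℂ A (S.rTensor A x) = ε a • b
  right : ∀ a b x, inc (A ⊗[ℂ] A) x = tmulOne a * Δ b →
    LinearMap.mul' ℂ A (S.lTensor A x) = ε b • a

/-! ### Existence of the counit and the antipode -/

lemma sliceR_sep (w : A ⊗[ℂ] A) (h : ∀ f : A →ₗ[ℂ] ℂ, sliceR f w = 0) : w = 0 := by
  let b := Module.Free.chooseBasis ℂ A
  apply (TensorProduct.equivFinsuppOfBasisRight (M := A) b).injective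
  ext i
  rw [TensorProduct.equivFinsuppOfBasisRight_apply]
  simpa [sliceR] using h (b.coord i)

lemma sliceL_sep (w : A ⊗[ℂ] A) (h : ∀ f : A →ₗ[ℂ] ℂ, sliceL f w = 0) : w = 0 := by
  let b := Module.Free.chooseBasis ℂ A
  apply (TensorProduct.equivFinsuppOfBasisLeft (N := A) b).injective
  ext i
  rw [TensorProduct.equivFinsuppOfBasisLeft_apply]
  simpa [sliceL] using h (b.coord i)

lemma sliceR_rTensor (f : A →ₗ[ℂ] ℂ) (g : A →ₗ[ℂ] A) (w : A ⊗[ℂ] A) :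
    sliceR f (g.rTensor A w) = g (sliceR f w) := by
  induction w with
  | zero => simp
  | add x y hx hy => simp only [map_add, hx, hy]
  | tmul a b => simp

lemma sliceL_lTensor (f : A →ₗ[ℂ] ℂ) (g : A →ₗ[ℂ] A) (w : A ⊗[ℂ] A) :
    sliceL f (g.lTensor A w) = g (sliceL f w) := by
  induction w with
  | zero => simp
  | add x y hx hy => simp only [map_add, hx, hy]
  | tmul a b => simp

/-- The product of `A ⊗ A` is non-degenerate. -/
lemma nondegenerate_tensor (hA : Nondegenerate A) : Nondegenerate (A ⊗[ℂ] A) := by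
  constructor
  · intro w h0
    have h1 : ∀ a b : A, (LinearMap.mulRight ℂ a).rTensor A
        ((LinearMap.mulRight ℂ b).lTensor A w) = 0 := by
      intro a b
      rw [← h0 (a ⊗ₜ b)]
      generalize w = z
      induction z with
      | zero => simp
      | add x y hx hy => simp only [map_add, hx, hy, add_mul]
      | tmul a b => simp
    have h2 : ∀ b : A, (LinearMap.mulRight ℂ b).lTensor A w = 0 := by
      intro b
      apply sliceR_sep
      intro f
      apply hA.left
      intro a
      have := congrArg (sliceR f) (h1 a b)
      rwa [sliceR_rTensor, map_zero] at this
    apply sliceL_sep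
    intro f
    apply hA.left
    intro b
    have := congrArg (sliceL f) (h2 b)
    rwa [sliceL_lTensor, map_zero] at this
  · intro w h0
    have h1 : ∀ a b : A, (LinearMap.mulLeft ℂ a).rTensor A
        ((LinearMap.mulLeft ℂ b).lTensor A w) = 0 := by
      intro a b
      rw [← h0 (a ⊗ₜ b)]
      generalize w = z
      induction z with
      | zero => simp
      | add x y hx hy => simp only [map_add, hx, hy, mul_add]
      | tmul a b => simp
    have h2 : ∀ b : A, (LinearMap.mulLeft ℂ b).lTensor A w = 0 := by
      intro b
      apply sliceR_sep
      intro f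
      apply hA.right
      intro a
      have := congrArg (sliceR f) (h1 a b)
      rwa [sliceR_rTensor, map_zero] at this
    apply sliceL_sep
    intro f
    apply hA.right
    intro b
    have := congrArg (sliceL f) (h2 b)
    rwa [sliceL_lTensor, map_zero] at this

lemma inc_injective (hA : Nondegenerate A) : Function.Injective (inc A) := by
  intro x y h
  rw [← sub_eq_zero]
  apply hA.left
  intro b
  have := congrArg (fun m => lmul m b) h
  simp only [lmul_inc] at this
  rw [sub_mul, this, sub_self]

lemma inc_lmul (hA : Nondegenerate A) (m : M A) (x : A) : inc A (lmul m x) = m * inc A x := by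
  refine ext_M (fun y => ?_) (fun y => ?_)
  · rw [lmul_inc, lmul_mul, lmul_inc, ← sub_eq_zero]
    apply hA.right
    intro a
    rw [mul_sub, ← mul_assoc, mul_lmul, mul_lmul, mul_assoc, sub_self]
  · rw [rmul_inc, rmul_mul, rmul_inc, mul_lmul]

lemma inc_rmul (hA : Nondegenerate A) (m : M A) (x : A) : inc A (rmul m x) = inc A x * m := by
  refine ext_M (fun y => ?_) (fun y => ?_)
  · rw [lmul_inc, lmul_mul, lmul_inc, mul_lmul]
  · rw [rmul_inc, rmul_mul, rmul_inc, ← sub_eq_zero]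
    apply hA.left
    intro a
    rw [sub_mul, mul_assoc, ← mul_lmul, ← mul_lmul, ← mul_assoc, sub_self]

lemma lmul_tmulOne (r : A) (x : A ⊗[ℂ] A) :
    lmul (tmulOne r) x = (LinearMap.mulLeft ℂ r).rTensor A x := rfl

lemma rmul_tmulOne (r : A) (x : A ⊗[ℂ] A) :
    rmul (tmulOne r) x = (LinearMap.mulRight ℂ r).rTensor A x := rfl

lemma lmul_oneTmul (r : A) (x : A ⊗[ℂ] A) :
    lmul (oneTmul r) x = (LinearMap.mulLeft ℂ r).lTensor A x := rfl

lemma rmul_oneTmul (r : A) (x : A ⊗[ℂ] A) :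
    rmul (oneTmul r) x = (LinearMap.mulRight ℂ r).lTensor A x := rfl

lemma inc_tmul (r s : A) : inc (A ⊗[ℂ] A) (r ⊗ₜ s) = oneTmul s * tmulOne r := by
  refine ext_M (fun y => ?_) (fun y => ?_)
  · rw [lmul_inc, lmul_mul, lmul_tmulOne, lmul_oneTmul]
    induction y with
    | zero => simp
    | add x y hx hy => simp only [map_add, hx, hy, mul_add]
    | tmul a b => simp
  · rw [rmul_inc, rmul_mul, rmul_tmulOne, rmul_oneTmul]
    induction y with
    | zero => simp
    | add x y hx hy => simp only [map_add, hx, hy, add_mul]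
    | tmul a b => simp

variable {Δ : A →ₗ[ℂ] M (A ⊗[ℂ] A)} {T₁ T₂ : A ⊗[ℂ] A ≃ₗ[ℂ] A ⊗[ℂ] A}

lemma T₁_mul (hA : Nondegenerate A) (hm : ∀ a b, Δ (a * b) = Δ a * Δ b)
    (h1 : ∀ a b, inc (A ⊗[ℂ] A) (T₁ (a ⊗ₜ b)) = Δ a * oneTmul b) (a b c : A) :
    T₁ ((a * b) ⊗ₜ c) = lmul (Δ a) (T₁ (b ⊗ₜ c)) := by
  apply inc_injective (nondegenerate_tensor hA)
  rw [inc_lmul (nondegenerate_tensor hA), h1, h1, hm, mul_assoc]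

lemma T₂_mul (hA : Nondegenerate A) (hm : ∀ a b, Δ (a * b) = Δ a * Δ b)
    (h2 : ∀ a b, inc (A ⊗[ℂ] A) (T₂ (a ⊗ₜ b)) = tmulOne a * Δ b) (a b c : A) :
    T₂ (a ⊗ₜ (b * c)) = rmul (Δ c) (T₂ (a ⊗ₜ b)) := by
  apply inc_injective (nondegenerate_tensor hA)
  rw [inc_rmul (nondegenerate_tensor hA), h2, h2, hm, mul_assoc]

lemma lmul_Δ (hA : Nondegenerate A)
    (h1 : ∀ a b, inc (A ⊗[ℂ] A) (T₁ (a ⊗ₜ b)) = Δ a * oneTmul b) (a r s : A) :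
    lmul (Δ a) (r ⊗ₜ s) = (LinearMap.mulRight ℂ r).rTensor A (T₁ (a ⊗ₜ s)) := by
  apply inc_injective (nondegenerate_tensor hA)
  rw [← rmul_tmulOne, inc_rmul (nondegenerate_tensor hA), inc_lmul (nondegenerate_tensor hA), h1,
    inc_tmul, mul_assoc]

lemma rmul_Δ (hA : Nondegenerate A)
    (h2 : ∀ a b, inc (A ⊗[ℂ] A) (T₂ (a ⊗ₜ b)) = tmulOne a * Δ b) (c x y : A) :
    rmul (Δ c) (x ⊗ₜ y) = (LinearMap.mulLeft ℂ y).lTensor A (T₂ (x ⊗ₜ c)) := by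
  apply inc_injective (nondegenerate_tensor hA)
  rw [← lmul_oneTmul, inc_lmul (nondegenerate_tensor hA), inc_rmul (nondegenerate_tensor hA), h2,
    inc_tmul, mul_assoc]

/-- Two linear maps that agree after composition with a surjection of `A ⊗ A` agree. -/
lemma eq_of_comp_equiv {N : Type*} [AddCommGroup N] [Module ℂ N] (T : A ⊗[ℂ] A ≃ₗ[ℂ] A ⊗[ℂ] A)
    (f g : A ⊗[ℂ] A →ₗ[ℂ] N) (h : ∀ a b, f (T (a ⊗ₜ b)) = g (T (a ⊗ₜ b))) (x : A ⊗[ℂ] A) :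
    f x = g x := by
  have : f ∘ₗ T.toLinearMap = g ∘ₗ T.toLinearMap := TensorProduct.ext' h
  have := LinearMap.congr_fun this (T.symm x)
  simpa using this

/-- `T₂ ⊗ ι` on `A ⊗ (A ⊗ A)`. -/
def T₂₁ (T₂ : A ⊗[ℂ] A ≃ₗ[ℂ] A ⊗[ℂ] A) : A ⊗[ℂ] (A ⊗[ℂ] A) →ₗ[ℂ] A ⊗[ℂ] (A ⊗[ℂ] A) :=
  (TensorProduct.assoc ℂ A A A).toLinearMap ∘ₗ T₂.toLinearMap.rTensor A ∘ₗ
    (TensorProduct.assoc ℂ A A A).symm.toLinearMap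

lemma T₂₁_tmul (a b c : A) :
    T₂₁ T₂ (a ⊗ₜ (b ⊗ₜ c)) = TensorProduct.assoc ℂ A A A (T₂ (a ⊗ₜ b) ⊗ₜ c) := by
  simp [T₂₁]

lemma coassoc_symm (h3 : ∀ a b c : A,
      TensorProduct.assoc ℂ A A A
          (T₂.toLinearMap.rTensor A ((TensorProduct.assoc ℂ A A A).symm (a ⊗ₜ T₁ (b ⊗ₜ c)))) =
        T₁.toLinearMap.lTensor A (TensorProduct.assoc ℂ A A A (T₂ (a ⊗ₜ b) ⊗ₜ c))) (a b c : A) :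
    TensorProduct.assoc ℂ A A A (T₂ (a ⊗ₜ b) ⊗ₜ c) =
      T₁.toLinearMap.lTensor A (T₂₁ T₂ (a ⊗ₜ T₁.symm (b ⊗ₜ c))) := by
  have key : ∀ w, T₂₁ T₂ (a ⊗ₜ T₁ w) = T₁.toLinearMap.lTensor A (T₂₁ T₂ (a ⊗ₜ w)) := by
    intro w
    induction w with
    | zero => simp
    | add x y hx hy => simp only [map_add, TensorProduct.tmul_add, hx, hy]
    | tmul b c => rw [T₂₁_tmul, ← h3]; rfl
  rw [← key, LinearEquiv.apply_symm_apply, T₂₁_tmul]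

lemma lTensor_assoc_mul (z : A ⊗[ℂ] A) (c : A) :
    (LinearMap.mul' ℂ A).lTensor A (TensorProduct.assoc ℂ A A A (z ⊗ₜ c)) =
      (LinearMap.mulRight ℂ c).lTensor A z := by
  induction z with
  | zero => simp
  | add x y hx hy => simp only [map_add, TensorProduct.add_tmul, hx, hy]
  | tmul a b => simp

lemma lTensor_assoc_sliceL (ε : A →ₗ[ℂ] ℂ) (z : A ⊗[ℂ] A) (c : A) :
    (sliceL ε).lTensor A (TensorProduct.assoc ℂ A A A (z ⊗ₜ c)) = sliceR ε z ⊗ₜ c := by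
  induction z with
  | zero => simp
  | add x y hx hy => simp only [map_add, TensorProduct.add_tmul, hx, hy]
  | tmul a b => simp [TensorProduct.smul_tmul]

lemma exists_counit (hA : Nondegenerate A) (hm : ∀ a b, Δ (a * b) = Δ a * Δ b)
    (h1 : ∀ a b, inc (A ⊗[ℂ] A) (T₁ (a ⊗ₜ b)) = Δ a * oneTmul b)
    (h2 : ∀ a b, inc (A ⊗[ℂ] A) (T₂ (a ⊗ₜ b)) = tmulOne a * Δ b)
    (h3 : ∀ a b c : A,
      TensorProduct.assoc ℂ A A A
          (T₂.toLinearMap.rTensor A ((TensorProduct.assoc ℂ A A A).symm (a ⊗ₜ T₁ (b ⊗ₜ c)))) =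
        T₁.toLinearMap.lTensor A (TensorProduct.assoc ℂ A A A (T₂ (a ⊗ₜ b) ⊗ₜ c))) :
    ∃ ε : A →ₗ[ℂ] ℂ, (∀ a b, ε (a * b) = ε a * ε b) ∧ (∀ a b, sliceL ε (T₁ (a ⊗ₜ b)) = a * b) ∧
      (∀ a b, sliceR ε (T₂ (a ⊗ₜ b)) = a * b) := by
  by_cases hs : ∀ x : A, x = 0
  · exact ⟨0, by simp, fun a b => (hs _).trans (hs _).symm, fun a b => (hs _).trans (hs _).symm⟩
  push Not at hs
  obtain ⟨x₀, hx₀⟩ := hs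
  obtain ⟨f, hf⟩ : ∃ f : A →ₗ[ℂ] ℂ, f x₀ = 1 := by
    obtain ⟨g, hg⟩ := LinearMap.exists_leftInverse_of_injective
      (LinearMap.toSpanSingleton ℂ A x₀) (LinearMap.ker_toSpanSingleton ℂ hx₀)
    refine ⟨g, ?_⟩
    have := LinearMap.congr_fun hg 1
    simpa using this
  set e : A ⊗[ℂ] A →ₗ[ℂ] A := LinearMap.mul' ℂ A ∘ₗ T₁.symm.toLinearMap with he
  set e' : A ⊗[ℂ] A →ₗ[ℂ] A := LinearMap.mul' ℂ A ∘ₗ T₂.symm.toLinearMap with he'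
  have hbal : ∀ a p q : A, (LinearMap.mulRight ℂ q).lTensor A (T₂ (a ⊗ₜ p)) =
      (LinearMap.mulLeft ℂ a).rTensor A (T₁ (p ⊗ₜ q)) := by
    intro a p q
    apply inc_injective (nondegenerate_tensor hA)
    rw [← rmul_oneTmul, ← lmul_tmulOne, inc_lmul (nondegenerate_tensor hA),
      inc_rmul (nondegenerate_tensor hA), h1, h2, mul_assoc]
  have hK : ∀ a v, (LinearMap.mul' ℂ A).lTensor A (T₂₁ T₂ (a ⊗ₜ v)) =
      (LinearMap.mulLeft ℂ a).rTensor A (T₁ v) := by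
    intro a v
    induction v with
    | zero => simp
    | add x y hx hy => simp only [map_add, TensorProduct.tmul_add, hx, hy]
    | tmul p q => rw [T₂₁_tmul, lTensor_assoc_mul, hbal]
  have heT : e ∘ₗ T₁.toLinearMap = LinearMap.mul' ℂ A := by
    refine LinearMap.ext fun a => ?_
    simp [he]
  have main : ∀ x y c : A, x ⊗ₜ[ℂ] e (y ⊗ₜ c) = e' (x ⊗ₜ y) ⊗ₜ[ℂ] c := by
    intro x y c
    have := eq_of_comp_equiv T₂
      (e.lTensor A ∘ₗ (TensorProduct.assoc ℂ A A A).toLinearMap ∘ₗ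
        (TensorProduct.mk ℂ (A ⊗[ℂ] A) A).flip c)
      ((TensorProduct.mk ℂ A A).flip c ∘ₗ e') (by
        intro a b
        simp only [LinearMap.comp_apply, LinearMap.flip_apply, TensorProduct.mk_apply,
          LinearEquiv.coe_coe]
        rw [coassoc_symm h3, ← LinearMap.comp_apply, ← LinearMap.lTensor_comp, heT, hK]
        simp [he']) (x ⊗ₜ y)
    simpa using this
  let ε : A →ₗ[ℂ] ℂ := f ∘ₗ e' ∘ₗ TensorProduct.mk ℂ A A x₀
  have E1 : ∀ y c, e (y ⊗ₜ c) = ε y • c := by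
    intro y c
    have := congrArg (sliceL f) (main x₀ y c)
    simpa [hf, ε] using this
  have E2 : ∀ x y, e' (x ⊗ₜ y) = ε y • x := by
    intro x y
    have := congrArg (sliceR f) (main x y x₀)
    simpa [E1, hf, mul_comm] using this.symm
  have C1 : ∀ w, sliceL ε w = e w := by
    intro w
    induction w with
    | zero => simp
    | add x y hx hy => simp only [map_add, hx, hy]
    | tmul a b => simp [E1]
  have C2 : ∀ w, sliceR ε w = e' w := by
    intro w
    induction w with
    | zero => simp
    | add x y hx hy => simp only [map_add, hx, hy]
    | tmul a b => simp [E2]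
  have C1' : ∀ a b, sliceL ε (T₁ (a ⊗ₜ b)) = a * b := by
    intro a b; rw [C1]; simp [he]
  have C2' : ∀ a b, sliceR ε (T₂ (a ⊗ₜ b)) = a * b := by
    intro a b; rw [C2]; simp [he']
  refine ⟨ε, ?_, C1', C2'⟩
  have H1 : ∀ (c : A) (z : A ⊗[ℂ] A), sliceR ε (rmul (Δ c) z) = sliceR ε z * c := by
    intro c z
    refine eq_of_comp_equiv T₂ (sliceR ε ∘ₗ rmul (Δ c))
      (LinearMap.mulRight ℂ c ∘ₗ sliceR ε) (fun a b => ?_) z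
    simp only [LinearMap.comp_apply, ← T₂_mul hA hm h2, C2', LinearMap.mulRight_apply, mul_assoc]
  have H2 : ∀ (y : A) (w : A ⊗[ℂ] A),
      sliceR ε ((LinearMap.mulLeft ℂ y).lTensor A w) = ε y • sliceR ε w := by
    intro y w
    refine eq_of_comp_equiv T₂ (sliceR ε ∘ₗ (LinearMap.mulLeft ℂ y).lTensor A)
      (ε y • sliceR ε) (fun x c => ?_) w
    simp only [LinearMap.comp_apply, ← rmul_Δ hA h2, H1, LinearMap.smul_apply, C2', sliceR_tmul,
      smul_mul_assoc]
  intro y q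
  have := congrArg f (H2 y (x₀ ⊗ₜ q))
  simpa [hf] using this

lemma exists_one {ε : A →ₗ[ℂ] ℂ} (hA : Nondegenerate A)
    (hε1 : ∀ a b, sliceL ε (T₁ (a ⊗ₜ b)) = a * b) (hs : ¬ ∀ x : A, x = 0) : ∃ a₀, ε a₀ = 1 := by
  by_contra! hne
  have h0 : ∀ a, ε a = 0 := by
    intro a
    by_contra h
    exact hne ((ε a)⁻¹ • a) (by simp [h])
  have h00 : ε = 0 := LinearMap.ext h0
  apply hs
  intro x
  apply hA.left
  intro b
  rw [← hε1, h00]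
  simp [sliceL]

lemma exists_antipode (hA : Nondegenerate A) (hm : ∀ a b, Δ (a * b) = Δ a * Δ b)
    (h1 : ∀ a b, inc (A ⊗[ℂ] A) (T₁ (a ⊗ₜ b)) = Δ a * oneTmul b)
    (h3 : ∀ a b c : A,
      TensorProduct.assoc ℂ A A A
          (T₂.toLinearMap.rTensor A ((TensorProduct.assoc ℂ A A A).symm (a ⊗ₜ T₁ (b ⊗ₜ c)))) =
        T₁.toLinearMap.lTensor A (TensorProduct.assoc ℂ A A A (T₂ (a ⊗ₜ b) ⊗ₜ c)))
    {ε : A →ₗ[ℂ] ℂ} (hε : ∀ a b, ε (a * b) = ε a * ε b)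
    (hε1 : ∀ a b, sliceL ε (T₁ (a ⊗ₜ b)) = a * b) (hε2 : ∀ a b, sliceR ε (T₂ (a ⊗ₜ b)) = a * b)
    {T₃ : A ⊗[ℂ] A →ₗ[ℂ] A ⊗[ℂ] A}
    (hT₃ : ∀ a r s, (LinearMap.mulRight ℂ s).lTensor A (T₃ (a ⊗ₜ r)) =
      (LinearMap.mulRight ℂ r).rTensor A (T₁ (a ⊗ₜ s))) :
    ∃ S : A →ₗ[ℂ] A, (∀ a b, S (a * b) = S b * S a) ∧
      (∀ a b, LinearMap.mul' ℂ A (S.rTensor A (T₁ (a ⊗ₜ b))) = ε a • b) ∧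
      (∀ a b, LinearMap.mul' ℂ A (S.lTensor A (T₂ (a ⊗ₜ b))) = ε b • a) := by
  by_cases hs : ∀ x : A, x = 0
  · exact ⟨0, by simp, fun a b => (hs _).trans (hs _).symm, fun a b => (hs _).trans (hs _).symm⟩
  obtain ⟨a₀, ha₀⟩ := exists_one hA hε1 hs
  set s : A ⊗[ℂ] A →ₗ[ℂ] A := sliceL ε ∘ₗ T₁.symm.toLinearMap with hs_def
  set s' : A ⊗[ℂ] A →ₗ[ℂ] A := sliceR ε ∘ₗ T₂.symm.toLinearMap with hs'_def
  have sT : ∀ w, s (T₁ w) = sliceL ε w := by intro w; simp [hs_def]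
  have s'T : ∀ w, s' (T₂ w) = sliceR ε w := by intro w; simp [hs'_def]
  have hsT : s ∘ₗ T₁.toLinearMap = sliceL ε := LinearMap.ext sT
  have mulT : ∀ w, LinearMap.mul' ℂ A (T₁.symm w) = sliceL ε w := by
    intro w
    symm
    refine eq_of_comp_equiv T₁ (sliceL ε) (LinearMap.mul' ℂ A ∘ₗ T₁.symm.toLinearMap)
      (fun a b => ?_) w
    simp [hε1]
  have hK : ∀ a v, (sliceL ε).lTensor A (T₂₁ T₂ (a ⊗ₜ v)) =
      (LinearMap.mulLeft ℂ a).rTensor A v := by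
    intro a v
    induction v with
    | zero => simp
    | add x y hx hy => simp only [map_add, TensorProduct.tmul_add, hx, hy]
    | tmul p q => rw [T₂₁_tmul, lTensor_assoc_sliceL, hε2]; simp
  have hmulL : ∀ (a : A) (v : A ⊗[ℂ] A),
      LinearMap.mul' ℂ A ((LinearMap.mulLeft ℂ a).rTensor A v) = a * LinearMap.mul' ℂ A v := by
    intro a v
    induction v with
    | zero => simp
    | add x y hx hy => simp only [map_add, mul_add, hx, hy]
    | tmul p q => simp [mul_assoc]
  have compat : ∀ x y c : A, x * s (y ⊗ₜ c) = s' (x ⊗ₜ y) * c := by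
    intro x y c
    have := eq_of_comp_equiv T₂
      (LinearMap.mul' ℂ A ∘ₗ s.lTensor A ∘ₗ (TensorProduct.assoc ℂ A A A).toLinearMap ∘ₗ
        (TensorProduct.mk ℂ (A ⊗[ℂ] A) A).flip c)
      (LinearMap.mulRight ℂ c ∘ₗ s') (by
        intro a b
        simp only [LinearMap.comp_apply, LinearMap.flip_apply, TensorProduct.mk_apply,
          LinearEquiv.coe_coe]
        rw [coassoc_symm h3, ← LinearMap.comp_apply (s.lTensor A), ← LinearMap.lTensor_comp, hsT,
          hK, hmulL, mulT, s'T]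
        simp [mul_smul_comm]) (x ⊗ₜ y)
    simpa using this
  have sR : ∀ y b c : A, s (y ⊗ₜ (b * c)) = s (y ⊗ₜ b) * c := by
    intro y b c
    rw [← sub_eq_zero]
    apply hA.right
    intro x
    rw [mul_sub, ← mul_assoc, compat, compat, mul_assoc, sub_self]
  have A1 : ∀ (a : A) (z : A ⊗[ℂ] A), s (lmul (Δ a) z) = ε a • s z := by
    intro a z
    refine eq_of_comp_equiv T₁ (s ∘ₗ lmul (Δ a)) (ε a • s) (fun b c => ?_) z
    simp only [LinearMap.comp_apply, LinearMap.smul_apply, ← T₁_mul hA hm h1, sT, sliceL_tmul, hε,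
      mul_smul]
  have A2 : ∀ (r : A) (w : A ⊗[ℂ] A),
      s ((LinearMap.mulRight ℂ r).rTensor A w) = s (r ⊗ₜ s w) := by
    intro r w
    refine eq_of_comp_equiv T₁ (s ∘ₗ (LinearMap.mulRight ℂ r).rTensor A)
      (s ∘ₗ TensorProduct.mk ℂ A A r ∘ₗ s) (fun a t => ?_) w
    simp only [LinearMap.comp_apply, ← lmul_Δ hA h1, A1, TensorProduct.mk_apply, sT, sliceL_tmul,
      map_smul]
  have A3 : ∀ p q r : A, s ((p * r) ⊗ₜ q) = s (r ⊗ₜ s (p ⊗ₜ q)) := by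
    intro p q r
    simpa using A2 r (p ⊗ₜ q)
  let S : A →ₗ[ℂ] A := s ∘ₗ T₃ ∘ₗ TensorProduct.mk ℂ A A a₀
  have sRw : ∀ (w : A ⊗[ℂ] A) (c : A), s w * c = s ((LinearMap.mulRight ℂ c).lTensor A w) := by
    intro w c
    induction w with
    | zero => simp
    | add x y hx hy => simp only [map_add, add_mul, hx, hy]
    | tmul p q => simp [sR]
  have hS : ∀ b c, S b * c = s (b ⊗ₜ c) := by
    intro b c
    change s (T₃ (a₀ ⊗ₜ b)) * c = _
    rw [sRw, hT₃, A2, sT, sliceL_tmul, ha₀, one_smul]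
  have hS' : ∀ x b, x * S b = s' (x ⊗ₜ b) := by
    intro x b
    rw [← sub_eq_zero]
    apply hA.left
    intro c
    rw [sub_mul, mul_assoc, hS, compat, sub_self]
  refine ⟨S, ?_, ?_, ?_⟩
  · intro a b
    rw [← sub_eq_zero]
    apply hA.left
    intro c
    rw [sub_mul, mul_assoc, hS, hS, hS, A3, sub_self]
  · have : ∀ w, LinearMap.mul' ℂ A (S.rTensor A w) = s w := by
      intro w
      induction w with
      | zero => simp
      | add x y hx hy => simp only [map_add, hx, hy]
      | tmul p q => simp [hS]
    intro a b
    rw [this, sT, sliceL_tmul]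
  · have : ∀ w, LinearMap.mul' ℂ A (S.lTensor A w) = s' w := by
      intro w
      induction w with
      | zero => simp
      | add x y hx hy => simp only [map_add, hx, hy]
      | tmul p q => simp [hS']
    intro a b
    rw [this, s'T, sliceR_tmul]
lemma counit_eq (hA : Nondegenerate A) {T₁' : A ⊗[ℂ] A ≃ₗ[ℂ] A ⊗[ℂ] A}
    (mix : ∀ a c d, (LinearMap.mulRight ℂ d).rTensor A (T₁ (a ⊗ₜ c)) =
      TensorProduct.comm ℂ A A ((LinearMap.mulRight ℂ c).rTensor A (T₁' (a ⊗ₜ d))))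
    {ε ε' : A →ₗ[ℂ] ℂ} (hε : ∀ a b, ε (a * b) = ε a * ε b) (hε' : ∀ a b, ε' (a * b) = ε' a * ε' b)
    (hε1 : ∀ a b, sliceL ε (T₁ (a ⊗ₜ b)) = a * b)
    (hε1' : ∀ a b, sliceL ε' (T₁' (a ⊗ₜ b)) = a * b) : ε' = ε := by
  by_cases hs : ∀ x : A, x = 0
  · refine LinearMap.ext fun a => ?_
    rw [hs a, map_zero, map_zero]
  obtain ⟨d, hd⟩ := exists_one hA hε1 hs
  obtain ⟨c, hc⟩ := exists_one hA hε1' hs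
  refine LinearMap.ext fun a => ?_
  have e1 : ∀ w : A ⊗[ℂ] A, sliceL ε ((LinearMap.mulRight ℂ d).rTensor A w) = ε d • sliceL ε w := by
    intro w
    induction w with
    | zero => simp
    | add x y hx hy => simp only [map_add, smul_add, hx, hy]
    | tmul p q => simp [hε, smul_smul, mul_comm]
  have e2 : ∀ w : A ⊗[ℂ] A, ε' (sliceL ε (TensorProduct.comm ℂ A A
      ((LinearMap.mulRight ℂ c).rTensor A w))) = ε (sliceL ε' w) * ε' c := by
    intro w
    induction w with
    | zero => simp
    | add x y hx hy => simp only [map_add, add_mul, hx, hy]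
    | tmul p q => simp [hε']; ring
  have := congrArg (fun w => ε' (sliceL ε w)) (mix a c d)
  simp only [e1, e2, hε1, hε1', map_smul, hε, hε', hd, hc] at this
  simpa using this

lemma antipode_inv (hA : Nondegenerate A) {T₁' T₂' : A ⊗[ℂ] A ≃ₗ[ℂ] A ⊗[ℂ] A}
    (mix : ∀ a c d, (LinearMap.mulRight ℂ d).rTensor A (T₁ (a ⊗ₜ c)) =
      TensorProduct.comm ℂ A A ((LinearMap.mulRight ℂ c).rTensor A (T₁' (a ⊗ₜ d))))
    {ε : A →ₗ[ℂ] ℂ} (hne : (¬ ∀ x : A, x = 0) → ∃ a₀, ε a₀ = 1) {S S' : A →ₗ[ℂ] A}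
    (hS' : ∀ a b, S' (a * b) = S' b * S' a)
    (h1 : ∀ a b, LinearMap.mul' ℂ A (S.rTensor A (T₁ (a ⊗ₜ b))) = ε a • b)
    (h1' : ∀ a b, LinearMap.mul' ℂ A (S'.rTensor A (T₁' (a ⊗ₜ b))) = ε a • b)
    (h2' : ∀ a b, LinearMap.mul' ℂ A (S'.lTensor A (T₂' (a ⊗ₜ b))) = ε b • a) (p : A) :
    S' (S p) = p := by
  by_cases hs : ∀ x : A, x = 0
  · exact (hs _).trans (hs _).symm
  obtain ⟨a₀, ha₀⟩ := hne hs
  -- `F₁ (p ⊗ q) = S'(q) p` and `F₂ (p ⊗ q) = S'(q) S'(S p)`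
  let F₁ : A ⊗[ℂ] A →ₗ[ℂ] A :=
    LinearMap.mul' ℂ A ∘ₗ S'.rTensor A ∘ₗ (TensorProduct.comm ℂ A A).toLinearMap
  let F₂ : A ⊗[ℂ] A →ₗ[ℂ] A := S' ∘ₗ LinearMap.mul' ℂ A ∘ₗ S.rTensor A
  have a1 : ∀ (w : A ⊗[ℂ] A) (d : A), F₁ w * d = F₁ ((LinearMap.mulRight ℂ d).rTensor A w) := by
    intro w d
    induction w with
    | zero => simp
    | add x y hx hy => simp only [map_add, add_mul, hx, hy]
    | tmul p q => simp [F₁, mul_assoc]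
  have a2 : ∀ (w : A ⊗[ℂ] A) (c : A), F₁ (TensorProduct.comm ℂ A A
      ((LinearMap.mulRight ℂ c).rTensor A w)) = S' c * LinearMap.mul' ℂ A (S'.rTensor A w) := by
    intro w c
    induction w with
    | zero => simp
    | add x y hx hy => simp only [map_add, mul_add, hx, hy]
    | tmul p q => simp [F₁, hS', mul_assoc]
  have key : ∀ w, F₁ w = F₂ w := by
    refine eq_of_comp_equiv T₁ F₁ F₂ fun a c => ?_
    rw [← sub_eq_zero]
    apply hA.left
    intro d
    rw [sub_mul, a1, mix, a2, h1']
    simp [F₂, h1, mul_smul_comm, smul_mul_assoc]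
  have key' : ∀ q, S' q * (p - S' (S p)) = 0 := by
    intro q
    have := key (p ⊗ₜ q)
    simp only [F₁, F₂, LinearMap.comp_apply, LinearEquiv.coe_coe, TensorProduct.comm_tmul,
      LinearMap.rTensor_tmul, LinearMap.mul'_apply, hS'] at this
    rw [mul_sub, this, sub_self]
  symm
  rw [← sub_eq_zero]
  apply hA.right
  intro x
  have : ∀ w : A ⊗[ℂ] A, LinearMap.mul' ℂ A (S'.lTensor A w) * (p - S' (S p)) = 0 := by
    intro w
    induction w with
    | zero => simp
    | add x y hx hy => simp only [map_add, add_mul, hx, hy, add_zero]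
    | tmul a b => simp only [LinearMap.lTensor_tmul, LinearMap.mul'_apply, mul_assoc, key', mul_zero]
  have := this (T₂' (x ⊗ₜ a₀))
  rwa [h2', ha₀, one_smul] at this

lemma lmul_flip (m : M (A ⊗[ℂ] A)) (x : A ⊗[ℂ] A) :
    lmul (flip m) x = TensorProduct.comm ℂ A A (lmul m (TensorProduct.comm ℂ A A x)) := rfl

namespace RegularMultiplierHopfAlgebra

variable (H : RegularMultiplierHopfAlgebra A)

theorem exists_structure : ∃ (ε : A →ₗ[ℂ] ℂ) (S : A ≃ₗ[ℂ] A),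
    IsCounit H.Δ ε ∧ IsAntipode H.Δ ε S.toLinearMap := by
  have hA := H.nondegenerate
  have hA2 := nondegenerate_tensor hA
  obtain ⟨hm, T₁, T₂, h1, h2, h3⟩ := H.isMultiplierHopf
  obtain ⟨hm', T₁', T₂', h1', h2', h3'⟩ := H.isMultiplierHopf_flip
  obtain ⟨ε, hε, e1, e2⟩ := exists_counit hA hm h1 h2 h3
  obtain ⟨ε', hε', e1', e2'⟩ := exists_counit hA hm' h1' h2' h3'
  have mix : ∀ a c d, (LinearMap.mulRight ℂ d).rTensor A (T₁ (a ⊗ₜ c)) =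
      TensorProduct.comm ℂ A A ((LinearMap.mulRight ℂ c).rTensor A (T₁' (a ⊗ₜ d))) := by
    intro a c d
    rw [← lmul_Δ hA h1, ← lmul_Δ hA h1', LinearMap.comp_apply, lmul_flip]
    simp
  have mix' : ∀ a c d, (LinearMap.mulRight ℂ d).rTensor A (T₁' (a ⊗ₜ c)) =
      TensorProduct.comm ℂ A A ((LinearMap.mulRight ℂ c).rTensor A (T₁ (a ⊗ₜ d))) := by
    intro a c d
    rw [mix]
    simp
  obtain rfl : ε' = ε := counit_eq hA mix hε hε' e1 e1'
  have hT : ∀ (z : A ⊗[ℂ] A) (s : A), (LinearMap.mulRight ℂ s).lTensor A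
      (TensorProduct.comm ℂ A A z) =
        TensorProduct.comm ℂ A A ((LinearMap.mulRight ℂ s).rTensor A z) := by
    intro z s
    induction z with
    | zero => simp
    | add x y hx hy => simp only [map_add, hx, hy]
    | tmul p q => simp
  obtain ⟨S, hS, s1, s2⟩ := exists_antipode hA hm h1 h3 hε e1 e2
    (T₃ := (TensorProduct.comm ℂ A A).toLinearMap ∘ₗ T₁'.toLinearMap) (by
      intro a r s
      rw [mix, ← hT]; rfl)
  obtain ⟨S', hS', s1', s2'⟩ := exists_antipode hA hm' h1' h3' hε e1' e2'
    (T₃ := (TensorProduct.comm ℂ A A).toLinearMap ∘ₗ T₁.toLinearMap) (by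
      intro a r s
      rw [mix', ← hT]; rfl)
  have i1 := antipode_inv hA mix (exists_one hA e1) hS' s1 s1' s2'
  have i2 := antipode_inv hA mix' (exists_one hA e1) hS s1' s1 s2
  refine ⟨ε', LinearEquiv.ofLinearMap S S' (LinearMap.ext i2) (LinearMap.ext i1), ?_, ?_⟩
  · refine ⟨hε, fun a b x hx => ?_, fun a b x hx => ?_⟩
    · rw [← h1] at hx
      rw [inc_injective hA2 hx, e1]
    · rw [← h2] at hx
      rw [inc_injective hA2 hx, e2]
  · refine ⟨hS, fun a b x hx => ?_, fun a b x hx => ?_⟩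
    · rw [← h1] at hx
      rw [inc_injective hA2 hx]
      exact s1 a b
    · rw [← h2] at hx
      rw [inc_injective hA2 hx]
      exact s2 a b

/-- The counit of a regular multiplier Hopf algebra. -/
def counit : A →ₗ[ℂ] ℂ := H.exists_structure.choose

/-- The antipode of a regular multiplier Hopf algebra, a bijection of `A`. -/
def antipode : A ≃ₗ[ℂ] A := H.exists_structure.choose_spec.choose

theorem isCounit : IsCounit H.Δ H.counit := H.exists_structure.choose_spec.choose_spec.1

theorem isAntipode : IsAntipode H.Δ H.counit H.antipode.toLinearMap :=
  H.exists_structure.choose_spec.choose_spec.2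

theorem antipode_mul (a b : A) : H.antipode (a * b) = H.antipode b * H.antipode a :=
  H.isAntipode.map_mul a b

theorem antipode_symm_mul (a b : A) :
    H.antipode.symm (a * b) = H.antipode.symm b * H.antipode.symm a := by
  apply H.antipode.injective
  simp [antipode_mul]

theorem antipode_tensor_mul (x y : A ⊗[ℂ] A) :
    TensorProduct.congr H.antipode H.antipode (x * y) =
      TensorProduct.congr H.antipode H.antipode y * TensorProduct.congr H.antipode H.antipode x := by
  induction x with
  | zero => simp
  | add x x' hx hx' => simp only [map_add, add_mul, mul_add, hx, hx']
  | tmul a b =>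
    induction y with
    | zero => simp
    | add y y' hy hy' => simp only [map_add, add_mul, mul_add, hy, hy']
    | tmul c d => simp [antipode_mul]

/-- The antipode `S` extended to `M(A)`. -/
def antipodeM : M A →ₗ[ℂ] M A := antiExt H.antipode H.antipode_mul

/-- The inverse `S⁻¹` of the antipode extended to `M(A)`. -/
def antipodeInvM : M A →ₗ[ℂ] M A := antiExt H.antipode.symm H.antipode_symm_mul

/-- `S ⊗ S` extended to `M(A ⊗ A)`. -/
def antipodeTensorM : M (A ⊗[ℂ] A) →ₗ[ℂ] M (A ⊗[ℂ] A) :=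
  antiExt (TensorProduct.congr H.antipode H.antipode) H.antipode_tensor_mul

/-- The homomorphism `ε ⊗ ι : A ⊗ A → A ⊆ M(A)`. -/
def counitL : A ⊗[ℂ] A →ₗ[ℂ] M A := inc A ∘ₗ sliceL H.counit

/-- The homomorphism `ι ⊗ ε : A ⊗ A → A ⊆ M(A)`. -/
def counitR : A ⊗[ℂ] A →ₗ[ℂ] M A := inc A ∘ₗ sliceR H.counit

/-- The homomorphism `Δ ⊗ ι : A ⊗ A → M(A ⊗ A ⊗ A)`. -/
def comulL : A ⊗[ℂ] A →ₗ[ℂ] M ((A ⊗[ℂ] A) ⊗[ℂ] A) :=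
  tens (A := A ⊗[ℂ] A) (B := A) ∘ₗ TensorProduct.map H.Δ (inc A)

/-- The homomorphism `ι ⊗ Δ : A ⊗ A → M(A ⊗ A ⊗ A)`. -/
def comulR : A ⊗[ℂ] A →ₗ[ℂ] M ((A ⊗[ℂ] A) ⊗[ℂ] A) :=
  transport (A := A ⊗[ℂ] (A ⊗[ℂ] A)) (B := (A ⊗[ℂ] A) ⊗[ℂ] A)
      (TensorProduct.assoc ℂ A A A).symm assoc_symm_mul ∘ₗ
    tens (A := A) (B := A ⊗[ℂ] A) ∘ₗ TensorProduct.map (inc A) H.Δ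

/-- `R` is a generalized R-matrix for `(A, Δ)`: an invertible multiplier of `A ⊗ A` with
`R Δ(a) = Δᶜᵒᵖ(a) R`, `(Δ ⊗ ι)(R) = R¹³ R²³`, `(ι ⊗ Δ)(R) = R¹³ R¹²`, and such that
`R (a ⊗ 1)` and `(a ⊗ 1) R` belong to `A ⊗ M(A)` for all `a`. -/
structure IsRMatrix (R : M (A ⊗[ℂ] A)) : Prop where
  isUnit : IsUnit R
  mul_comul : ∀ a, R * H.Δ a = flip (H.Δ a) * R
  comul_left : Extends (A := A ⊗[ℂ] A) (B := (A ⊗[ℂ] A) ⊗[ℂ] A) H.comulL R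
    (leg13 R * leg23 R)
  comul_right : Extends (A := A ⊗[ℂ] A) (B := (A ⊗[ℂ] A) ⊗[ℂ] A) H.comulR R
    (leg13 R * leg12 R)
  mul_mem : ∀ a, ∃ x : A ⊗[ℂ] M A, emb x = R * tmulOne a
  mem_mul : ∀ a, ∃ x : A ⊗[ℂ] M A, emb x = tmulOne a * R

end RegularMultiplierHopfAlgebra

/-- The linear map `A ⊗ M(A) → A`, `x ⊗ m ↦ f(m) g(x)`. -/
def contract (f : M A →ₗ[ℂ] M A) (g : A →ₗ[ℂ] A) : A ⊗[ℂ] M A →ₗ[ℂ] A :=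
  TensorProduct.lift <| LinearMap.mk₂ ℂ (fun x m => lmul (f m) (g x))
    (by intro x y m; simp) (by intro c x m; simp) (by intro x m n; simp) (by intro c x m; simp)

end Hopf

end MultHopf

end

/-!
The classical argument for quasitriangular Hopf algebras evaluates the hexagon identities
`(Δ ⊗ ι)(R) = R¹³ R²³` and `(ι ⊗ Δ)(R) = R¹³ R¹²` with the counit and the antipode. It survives in
the multiplier setting once both identities are covered: multiplied by suitable elements of `A` so
that both sides become elements of `A ⊗ A ⊗ A`, to which any linear map can be applied. The
covering elements are chosen so that `R¹³` acts on an element of `A ⊗ A ⊗ A`, the other factor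
enters through `R (a ⊗ 1) = ∑ x¹ ⊗ x²` or `(c ⊗ 1) R = ∑ y¹ ⊗ y²` in `A ⊗ M(A)`, and `Δ` through
`(a ⊗ 1) Δ(b)` or `(1 ⊗ a) Δ(b)` (`IsRMatrix.leg13_coverL`,
`IsRMatrix.leg13_coverR`).

* Applying `ε` to an outer leg shows that the slice of `R` by `ε` acts trivially on the range of
  `R`, which is everything because `R` is invertible (`IsRMatrix.sliceL_counit_lmul`,
  `IsRMatrix.sliceR_counit_lmul`).
* Applying `p ⊗ s ⊗ t ↦ p ⊗ t S⁻¹(s)` and `s ⊗ t ⊗ v ↦ s S(t) ⊗ v` shows that `(ι ⊗ S⁻¹)(R)` and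
  `(S ⊗ ι)(R)` are right inverses of `R` (`IsRMatrix.mul_emb_antipodeInvM`,
  `IsRMatrix.mul_emb_antipode`). The formulas with `a ⊗ 1` on the other side of `R⁻¹` follow by
  comparing `(c ⊗ 1) R⁻¹ (a ⊗ 1)`, and `(S ⊗ S)(R) = R` by comparing the two expressions for `R⁻¹`.
* Let `U(a) = ∑ S(R⁽²⁾) R⁽¹⁾ a`. The map `s ⊗ t ↦ S(t) s` sends `R (s ⊗ t)` to `S(t) U(s)`, so
  `R Δ(h) = Δᶜᵒᵖ(h) R` yields `∑ S(h₂) U(h₁ a) = ε(h) U(a)` and then `U(p a) = S²(p) U(a)`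
  (`contract_mul_left`). Hence `U` is left multiplication by a multiplier, whose right
  multiplication is `a ↦ U(S⁻²(a))`. The same lemma applies to `Δᶜᵒᵖ`, `S⁻¹` and `R⁻¹`; the
  resulting map is `∑ S⁻²(R⁽²⁾) R⁽¹⁾ a`, and `R R⁻¹ = 1 = R⁻¹ R` makes it inverse to `U`
  (`contract_contract`). The other expressions for `u⁻¹` follow from `(S ⊗ S)(R) = R` in
  `A ⊗ M(A)`.
-/

noncomputable section

namespace MultHopf

/-! ### Multipliers of non-degenerate algebras -/

section Multiplier

variable {A : Type*} [NonUnitalRing A] [Module ℂ A] [IsScalarTower ℂ A A] [SMulCommClass ℂ A A]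
variable {B : Type*} [NonUnitalRing B] [Module ℂ B] [IsScalarTower ℂ B B] [SMulCommClass ℂ B B]

lemma lmul_zero (a : A) : lmul (0 : M A) a = 0 := rfl

lemma ext_lmul (hA : Nondegenerate A) {m n : M A} (h : ∀ a, lmul m a = lmul n a) : m = n := by
  refine ext_M h fun a => ?_
  rw [← sub_eq_zero]
  apply hA.left
  intro b
  rw [sub_mul, ← mul_lmul, ← mul_lmul, h, sub_self]

lemma ext_rmul (hA : Nondegenerate A) {m n : M A} (h : ∀ a, rmul m a = rmul n a) : m = n := by
  refine ext_M (fun a => ?_) h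
  rw [← sub_eq_zero]
  apply hA.right
  intro b
  rw [mul_sub, mul_lmul, mul_lmul, h, sub_self]

lemma lmul_rmul_comm (hA : Nondegenerate A) (m n : M A) (a : A) :
    lmul m (rmul n a) = rmul n (lmul m a) := by
  apply inc_injective hA
  rw [inc_lmul hA, inc_rmul hA, inc_rmul hA, inc_lmul hA, mul_assoc]

lemma lmul_mul_right (hA : Nondegenerate A) (m : M A) (a b : A) :
    lmul m (a * b) = lmul m a * b :=
  lmul_rmul_comm hA m (inc A b) a

lemma Nondegenerate.eq_of_mul_right (hA : Nondegenerate A) {a b : A} (h : ∀ c, a * c = b * c) :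
    a = b := by
  rw [← sub_eq_zero]
  exact hA.left _ fun c => by rw [sub_mul, h, sub_self]

lemma Nondegenerate.eq_of_mul_left (hA : Nondegenerate A) {a b : A} (h : ∀ c, c * a = c * b) :
    a = b := by
  rw [← sub_eq_zero]
  exact hA.right _ fun c => by rw [mul_sub, h, sub_self]

/-- Functionals on the left factor separate the points of a tensor product of vector spaces. -/
lemma tmul_sep_left {V W : Type*} [AddCommGroup V] [Module ℂ V] [AddCommGroup W] [Module ℂ W]
    {w w' : V ⊗[ℂ] W}
    (h : ∀ f : V →ₗ[ℂ] ℂ, TensorProduct.lid ℂ W (f.rTensor W w) =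
      TensorProduct.lid ℂ W (f.rTensor W w')) : w = w' := by
  let b := Module.Free.chooseBasis ℂ V
  apply (TensorProduct.equivFinsuppOfBasisLeft (N := W) b).injective
  ext i
  rw [TensorProduct.equivFinsuppOfBasisLeft_apply, TensorProduct.equivFinsuppOfBasisLeft_apply]
  exact h (b.coord i)

/-- Functionals on the right factor separate the points of a tensor product of vector spaces. -/
lemma tmul_sep_right {V W : Type*} [AddCommGroup V] [Module ℂ V] [AddCommGroup W] [Module ℂ W]
    {w w' : V ⊗[ℂ] W}
    (h : ∀ f : W →ₗ[ℂ] ℂ, TensorProduct.rid ℂ V (f.lTensor V w) =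
      TensorProduct.rid ℂ V (f.lTensor V w')) : w = w' := by
  let b := Module.Free.chooseBasis ℂ W
  apply (TensorProduct.equivFinsuppOfBasisRight (M := V) b).injective
  ext i
  rw [TensorProduct.equivFinsuppOfBasisRight_apply, TensorProduct.equivFinsuppOfBasisRight_apply]
  exact h (b.coord i)

/-- A family of linear maps that is jointly injective on `V` stays so after tensoring with `W`. -/
lemma eq_of_rTensor {V V' W ι : Type*} [AddCommGroup V] [Module ℂ V] [AddCommGroup V']
    [Module ℂ V'] [AddCommGroup W] [Module ℂ W] (g : ι → V →ₗ[ℂ] V')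
    (hg : ∀ v v', (∀ i, g i v = g i v') → v = v') {w w' : V ⊗[ℂ] W}
    (h : ∀ i, (g i).rTensor W w = (g i).rTensor W w') : w = w' := by
  refine tmul_sep_right fun f => hg _ _ fun i => ?_
  have nat : ∀ z : V ⊗[ℂ] W, g i (TensorProduct.rid ℂ V (f.lTensor V z)) =
      TensorProduct.rid ℂ V' (f.lTensor V' ((g i).rTensor W z)) := by
    intro z
    induction z with
    | zero => simp
    | add x y hx hy => simp only [map_add, hx, hy]
    | tmul a b => simp
  rw [nat, nat, h]

/-- A family of linear maps that is jointly injective on `W` stays so after tensoring with `V`. -/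
lemma eq_of_lTensor {V W W' ι : Type*} [AddCommGroup V] [Module ℂ V] [AddCommGroup W]
    [Module ℂ W] [AddCommGroup W'] [Module ℂ W'] (g : ι → W →ₗ[ℂ] W')
    (hg : ∀ v v', (∀ i, g i v = g i v') → v = v') {w w' : V ⊗[ℂ] W}
    (h : ∀ i, (g i).lTensor V w = (g i).lTensor V w') : w = w' := by
  refine tmul_sep_left fun f => hg _ _ fun i => ?_
  have nat : ∀ z : V ⊗[ℂ] W, g i (TensorProduct.lid ℂ W (f.rTensor W z)) =
      TensorProduct.lid ℂ W' (f.rTensor W' ((g i).lTensor V z)) := by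
    intro z
    induction z with
    | zero => simp
    | add x y hx hy => simp only [map_add, hx, hy]
    | tmul a b => simp
  rw [nat, nat, h]

lemma eq_of_mul_tmul (hA : Nondegenerate A) (hB : Nondegenerate B) {w w' : A ⊗[ℂ] B}
    (h : ∀ a b, w * a ⊗ₜ[ℂ] b = w' * a ⊗ₜ[ℂ] b) : w = w' := by
  have split : ∀ (z : A ⊗[ℂ] B) (a : A) (b : B),
      (LinearMap.mulRight ℂ a).rTensor B ((LinearMap.mulRight ℂ b).lTensor A z) =
        z * a ⊗ₜ[ℂ] b := by
    intro z a b
    induction z with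
    | zero => simp
    | add x y hx hy => simp only [map_add, add_mul, hx, hy]
    | tmul p q => simp
  refine eq_of_lTensor (fun b : B => LinearMap.mulRight ℂ b)
    (fun _ _ => hB.eq_of_mul_right) fun b => ?_
  refine eq_of_rTensor (fun a : A => LinearMap.mulRight ℂ a)
    (fun _ _ => hA.eq_of_mul_right) fun a => ?_
  rw [split, split, h]

lemma eq_of_tmul_mul (hA : Nondegenerate A) (hB : Nondegenerate B) {w w' : A ⊗[ℂ] B}
    (h : ∀ a b, a ⊗ₜ[ℂ] b * w = a ⊗ₜ[ℂ] b * w') : w = w' := by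
  have split : ∀ (z : A ⊗[ℂ] B) (a : A) (b : B),
      (LinearMap.mulLeft ℂ a).rTensor B ((LinearMap.mulLeft ℂ b).lTensor A z) =
        a ⊗ₜ[ℂ] b * z := by
    intro z a b
    induction z with
    | zero => simp
    | add x y hx hy => simp only [map_add, mul_add, hx, hy]
    | tmul p q => simp
  refine eq_of_lTensor (fun b : B => LinearMap.mulLeft ℂ b)
    (fun _ _ => hB.eq_of_mul_left) fun b => ?_
  refine eq_of_rTensor (fun a : A => LinearMap.mulLeft ℂ a)
    (fun _ _ => hA.eq_of_mul_left) fun a => ?_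
  rw [split, split, h]

lemma Nondegenerate.tensor (hA : Nondegenerate A) (hB : Nondegenerate B) :
    Nondegenerate (A ⊗[ℂ] B) where
  left w h := eq_of_mul_tmul hA hB fun a b => by rw [h, zero_mul]
  right w h := eq_of_tmul_mul hA hB fun a b => by rw [h, mul_zero]

/-! ### Elements of `A ⊗ M(A)` as multipliers -/

variable (A) in
/-- The linear map `m ↦ m b` from `M(A)` to `A`. -/
def lmulAt (b : A) : M A →ₗ[ℂ] A where
  toFun m := lmul m b
  map_add' _ _ := rfl
  map_smul' _ _ := rfl

variable (A) in
/-- The linear map `m ↦ b m` from `M(A)` to `A`. -/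
def rmulAt (b : A) : M A →ₗ[ℂ] A where
  toFun m := rmul m b
  map_add' _ _ := rfl
  map_smul' _ _ := rfl

@[simp] lemma lmulAt_apply (b : A) (m : M A) : lmulAt A b m = lmul m b := rfl
@[simp] lemma rmulAt_apply (b : A) (m : M A) : rmulAt A b m = rmul m b := rfl

lemma lmul_emb_tmul (x : A ⊗[ℂ] M A) (p b : A) :
    lmul (emb x) (p ⊗ₜ b) = rmul (tmulOne p) ((lmulAt A b).lTensor A x) := by
  induction x with
  | zero => simp only [map_zero]; rfl
  | add x y hx hy => simp only [map_add, lmul_add, hx, hy]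
  | tmul a m => simp [emb, rmul_tmulOne]

lemma rmul_emb_tmul (x : A ⊗[ℂ] M A) (p b : A) :
    rmul (emb x) (p ⊗ₜ b) = lmul (tmulOne p) ((rmulAt A b).lTensor A x) := by
  induction x with
  | zero => simp only [map_zero]; rfl
  | add x y hx hy => simp only [map_add, rmul_add, hx, hy]
  | tmul a m => simp [emb, lmul_tmulOne]

lemma emb_injective (hA : Nondegenerate A) :
    Function.Injective (emb : A ⊗[ℂ] M A → M (A ⊗[ℂ] A)) := by
  intro x y h
  refine eq_of_lTensor (fun b : A => lmulAt A b) (fun _ _ => ext_lmul hA) fun b => ?_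
  refine eq_of_rTensor (fun a : A => LinearMap.mulRight ℂ a)
    (fun _ _ => hA.eq_of_mul_right) fun p => ?_
  rw [← rmul_tmulOne, ← rmul_tmulOne, ← lmul_emb_tmul, ← lmul_emb_tmul, h]

lemma tens_mul (m m' : M A) (n n' : M B) :
    tens (m ⊗ₜ[ℂ] n) * tens (m' ⊗ₜ[ℂ] n') = tens ((m * m') ⊗ₜ[ℂ] (n * n')) := by
  refine ext_M (fun x => ?_) (fun x => ?_) <;> induction x with
  | zero => simp
  | add x x' hx hx' => simp only [map_add, hx, hx']
  | tmul a b => simp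

lemma inc_mul (a b : A) : inc A (a * b) = inc A a * inc A b :=
  ext_M (fun x => mul_assoc a b x) (fun x => (mul_assoc x a b).symm)

lemma emb_map_mulLeft (a : A) (x : A ⊗[ℂ] M A) :
    emb (TensorProduct.map (LinearMap.mulLeft ℂ a) LinearMap.id x) = tmulOne a * emb x := by
  induction x with
  | zero => simp
  | add x y hx hy => simp only [map_add, mul_add, hx, hy]
  | tmul b m => simp [emb, tmulOne, tens_mul, inc_mul]

lemma emb_map_mulRight (a : A) (x : A ⊗[ℂ] M A) :
    emb (TensorProduct.map (LinearMap.mulRight ℂ a) LinearMap.id x) = emb x * tmulOne a := by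
  induction x with
  | zero => simp
  | add x y hx hy => simp only [map_add, add_mul, hx, hy]
  | tmul b m => simp [emb, tmulOne, tens_mul, inc_mul]

lemma tmulOne_mul (a b : A) : (tmulOne (a * b) : M (A ⊗[ℂ] A)) = tmulOne a * tmulOne b := by
  simp [tmulOne, tens_mul, inc_mul]

lemma eq_of_mul_tmulOne (hA : Nondegenerate A) {m n : M (A ⊗[ℂ] A)}
    (h : ∀ a, m * tmulOne a = n * tmulOne a) : m = n := by
  refine ext_rmul (hA.tensor hA) fun z => ?_
  refine eq_of_rTensor (fun a : A => LinearMap.mulRight ℂ a)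
    (fun _ _ => hA.eq_of_mul_right) fun a => ?_
  rw [← rmul_tmulOne, ← rmul_mul, h, rmul_mul, rmul_tmulOne]

/-- `Q (a ⊗ b) = ∑ x¹ ⊗ x² b` if `Q (a ⊗ 1) = ∑ x¹ ⊗ x²` in `A ⊗ M(A)`. -/
lemma lmul_tmul_of_emb (hA : Nondegenerate A) {Q : M (A ⊗[ℂ] A)} {a : A} {x : A ⊗[ℂ] M A}
    (hx : emb x = Q * tmulOne a) (b : A) : lmul Q (a ⊗ₜ b) = (lmulAt A b).lTensor A x := by
  refine eq_of_rTensor (fun a : A => LinearMap.mulRight ℂ a)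
    (fun _ _ => hA.eq_of_mul_right) fun p => ?_
  rw [← rmul_tmulOne, ← rmul_tmulOne, ← lmul_emb_tmul, hx, ← lmul_rmul_comm (hA.tensor hA)]
  simp [lmul_tmulOne, rmul_tmulOne]

lemma rmul_tmul_of_emb (hA : Nondegenerate A) {Q : M (A ⊗[ℂ] A)} {a : A} {x : A ⊗[ℂ] M A}
    (hx : emb x = tmulOne a * Q) (b : A) : rmul Q (a ⊗ₜ b) = (rmulAt A b).lTensor A x := by
  refine eq_of_rTensor (fun a : A => LinearMap.mulLeft ℂ a)
    (fun _ _ => hA.eq_of_mul_left) fun p => ?_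
  rw [← lmul_tmulOne, ← lmul_tmulOne, ← rmul_emb_tmul, hx, lmul_rmul_comm (hA.tensor hA)]
  simp [lmul_tmulOne, rmul_tmulOne]

/-- `(c ⊗ 1) (Q (a ⊗ 1)) = ((c ⊗ 1) Q) (a ⊗ 1)` in `A ⊗ M(A)`. -/
lemma map_mulLeft_eq_map_mulRight (hA : Nondegenerate A) {Q : M (A ⊗[ℂ] A)} {a c : A}
    {x y : A ⊗[ℂ] M A} (hx : emb x = Q * tmulOne a) (hy : emb y = tmulOne c * Q) :
    TensorProduct.map (LinearMap.mulLeft ℂ c) LinearMap.id x =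
      TensorProduct.map (LinearMap.mulRight ℂ a) LinearMap.id y := by
  apply emb_injective hA
  rw [emb_map_mulLeft, emb_map_mulRight, hx, hy, mul_assoc]

lemma exists_linear_lift (hA : Nondegenerate A) {Q : M (A ⊗[ℂ] A)}
    (h : ∀ a, ∃ x : A ⊗[ℂ] M A, emb x = Q * tmulOne a) :
    ∃ X : A →ₗ[ℂ] A ⊗[ℂ] M A, ∀ a, emb (X a) = Q * tmulOne a := by
  choose X hX using h
  refine ⟨{ toFun := X, map_add' := fun a b => ?_, map_smul' := fun c a => ?_ }, hX⟩
  · apply emb_injective hA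
    simp [hX, tmulOne, TensorProduct.add_tmul, mul_add]
  · apply emb_injective hA
    simp [hX, tmulOne, ← TensorProduct.smul_tmul']

end Multiplier


section Legs

variable {A : Type*} [NonUnitalRing A] [Module ℂ A] [IsScalarTower ℂ A A] [SMulCommClass ℂ A A]

/-! ### Multipliers of the threefold tensor product -/

lemma lmul_leg12_tmul (m : M (A ⊗[ℂ] A)) (w : A ⊗[ℂ] A) (t : A) :
    lmul (leg12 m) (w ⊗ₜ t) = lmul m w ⊗ₜ t := rfl

lemma lmul_leg13_tmul (m : M (A ⊗[ℂ] A)) (p s t : A) :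
    lmul (leg13 m) ((p ⊗ₜ s) ⊗ₜ t) = TensorProduct.rightComm ℂ A A A (lmul m (p ⊗ₜ t) ⊗ₜ s) := rfl

lemma lmul_leg23 (m : M (A ⊗[ℂ] A)) (w : (A ⊗[ℂ] A) ⊗[ℂ] A) :
    lmul (leg23 m) w = (TensorProduct.assoc ℂ A A A).symm
      ((lmul m).lTensor A (TensorProduct.assoc ℂ A A A w)) := rfl

lemma leg12_mul (m n : M (A ⊗[ℂ] A)) : leg12 (m * n) = leg12 m * leg12 n := by
  simp [leg12, tens_mul]

variable (A) in
/-- Left multiplication by `1 ⊗ c ⊗ 1` on `A ⊗ A ⊗ A`. -/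
def midMul (c : A) : (A ⊗[ℂ] A) ⊗[ℂ] A →ₗ[ℂ] (A ⊗[ℂ] A) ⊗[ℂ] A :=
  ((LinearMap.mulLeft ℂ c).lTensor A).rTensor A

@[simp] lemma midMul_tmul (c : A) (w : A ⊗[ℂ] A) (t : A) :
    midMul A c (w ⊗ₜ t) = (LinearMap.mulLeft ℂ c).lTensor A w ⊗ₜ t := rfl

lemma midMul_assoc_symm (c p : A) (w : A ⊗[ℂ] A) :
    midMul A c ((TensorProduct.assoc ℂ A A A).symm (p ⊗ₜ w)) =
      (TensorProduct.assoc ℂ A A A).symm (p ⊗ₜ (LinearMap.mulLeft ℂ c).rTensor A w) := by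
  induction w with
  | zero => simp
  | add x y hx hy => simp only [map_add, TensorProduct.tmul_add, hx, hy]
  | tmul a b => simp

lemma leg13_midMul (m : M (A ⊗[ℂ] A)) (c : A) (w : (A ⊗[ℂ] A) ⊗[ℂ] A) :
    lmul (leg13 m) (midMul A c w) = midMul A c (lmul (leg13 m) w) := by
  have h : ∀ (z : A ⊗[ℂ] A) (s : A),
      TensorProduct.rightComm ℂ A A A (z ⊗ₜ (c * s)) =
        midMul A c (TensorProduct.rightComm ℂ A A A (z ⊗ₜ s)) := by
    intro z s
    induction z with
    | zero => simp
    | add x y hx hy => simp only [map_add, TensorProduct.add_tmul, hx, hy]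
    | tmul a b => simp
  induction w with
  | zero => simp
  | add x y hx hy => simp only [map_add, hx, hy]
  | tmul a t =>
    induction a with
    | zero => simp
    | add x y hx hy => simp only [map_add, TensorProduct.add_tmul, hx, hy]
    | tmul p s => simp [lmul_leg13_tmul, h]

lemma lmul_leg23_tmulOne_mul (m : M (A ⊗[ℂ] A)) (c : A) (w : (A ⊗[ℂ] A) ⊗[ℂ] A) :
    lmul (leg23 (tmulOne c * m)) w = midMul A c (lmul (leg23 m) w) := by
  rw [lmul_leg23, lmul_leg23]
  generalize TensorProduct.assoc ℂ A A A w = u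
  induction u with
  | zero => simp
  | add x y hx hy => simp only [map_add, hx, hy]
  | tmul p z => simp [midMul_assoc_symm, lmul_tmulOne]

lemma eq_of_mul_tmul_tmul (hA : Nondegenerate A) {w w' : (A ⊗[ℂ] A) ⊗[ℂ] A}
    (h : ∀ p s t : A, w * ((p ⊗ₜ s) ⊗ₜ t) = w' * ((p ⊗ₜ s) ⊗ₜ t)) : w = w' := by
  refine eq_of_mul_tmul (hA.tensor hA) hA fun z t => ?_
  induction z with
  | zero => simp
  | add x y hx hy => simp only [TensorProduct.add_tmul, mul_add, hx, hy]
  | tmul p s => exact h p s t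

lemma assoc_symm_tmul_mul (a p s t : A) (w : A ⊗[ℂ] A) :
    (TensorProduct.assoc ℂ A A A).symm (a ⊗ₜ w) * ((p ⊗ₜ s) ⊗ₜ t) =
      (TensorProduct.assoc ℂ A A A).symm ((a * p) ⊗ₜ (w * s ⊗ₜ t)) := by
  rw [← TensorProduct.assoc_symm_tmul, ← assoc_symm_mul, Algebra.TensorProduct.tmul_mul_tmul]

end Legs

namespace RegularMultiplierHopfAlgebra

variable {A : Type*} [NonUnitalRing A] [Module ℂ A] [IsScalarTower ℂ A A] [SMulCommClass ℂ A A]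
  (H : RegularMultiplierHopfAlgebra A)

/-! ### The comultiplication and the antipode in covered form -/

/-- The linear map `a ⊗ b ↦ (a ⊗ 1) Δ(b)`, with its values in `A ⊗ A`. -/
def coverL : A ⊗[ℂ] A →ₗ[ℂ] A ⊗[ℂ] A := H.isMultiplierHopf.2.choose_spec.choose.toLinearMap

lemma inc_coverL (a b : A) : inc (A ⊗[ℂ] A) (H.coverL (a ⊗ₜ b)) = tmulOne a * H.Δ b :=
  H.isMultiplierHopf.2.choose_spec.choose_spec.2.1 a b

/-- The linear map `a ⊗ b ↦ (1 ⊗ a) Δ(b)`, with its values in `A ⊗ A`; it exists because `σΔ` is a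
comultiplication as well. -/
def coverR : A ⊗[ℂ] A →ₗ[ℂ] A ⊗[ℂ] A :=
  (TensorProduct.comm ℂ A A).toLinearMap ∘ₗ
    H.isMultiplierHopf_flip.2.choose_spec.choose.toLinearMap

lemma coverL_mul (a b : A) (z : A ⊗[ℂ] A) :
    H.coverL (a ⊗ₜ b) * z = (LinearMap.mulLeft ℂ a).rTensor A (lmul (H.Δ b) z) :=
  congrArg (fun m => lmul m z) (H.inc_coverL a b)

lemma coverR_mul (a b : A) (z : A ⊗[ℂ] A) :
    H.coverR (a ⊗ₜ b) * z = (LinearMap.mulLeft ℂ a).lTensor A (lmul (H.Δ b) z) := by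
  have h := congrArg (fun m => lmul m (TensorProduct.comm ℂ A A z))
    (H.isMultiplierHopf_flip.2.choose_spec.choose_spec.2.1 a b)
  have h' := congrArg (TensorProduct.comm ℂ A A) h
  simp only [lmul_inc, comm_mul, lmul_mul, lmul_tmulOne, LinearMap.comp_apply, lmul_flip] at h'
  have comm_comm : ∀ w : A ⊗[ℂ] A,
      TensorProduct.comm ℂ A A (TensorProduct.comm ℂ A A w) = w := fun w => by simp
  have nat : ∀ w : A ⊗[ℂ] A, TensorProduct.comm ℂ A A ((LinearMap.mulLeft ℂ a).rTensor A
      (TensorProduct.comm ℂ A A w)) = (LinearMap.mulLeft ℂ a).lTensor A w := by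
    intro w
    induction w with
    | zero => simp
    | add x y hx hy => simp only [map_add, hx, hy]
    | tmul p q => simp
  rw [comm_comm, nat] at h'
  exact h'

/-- `(ι ⊗ ε)((a ⊗ 1) Δ(b)) = a b`. -/
lemma sliceR_coverL (a b : A) : sliceR H.counit (H.coverL (a ⊗ₜ b)) = a * b :=
  H.isCounit.right a b _ (H.inc_coverL a b)

/-- `a b₁ S(b₂) = ε(b) a`. -/
lemma mul_antipode_coverL (a b : A) :
    LinearMap.mul' ℂ A (H.antipode.toLinearMap.lTensor A (H.coverL (a ⊗ₜ b))) = H.counit b • a :=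
  H.isAntipode.right a b _ (H.inc_coverL a b)

/-- `(a ⊗ 1)((1 ⊗ c) Δ(b)) = (1 ⊗ c)((a ⊗ 1) Δ(b))`. -/
lemma mulLeft_coverR (a b c : A) :
    (LinearMap.mulLeft ℂ a).rTensor A (H.coverR (c ⊗ₜ b)) =
      (LinearMap.mulLeft ℂ c).lTensor A (H.coverL (a ⊗ₜ b)) := by
  have hA2 := H.nondegenerate.tensor H.nondegenerate
  refine hA2.eq_of_mul_right fun z => ?_
  rw [← lmul_tmulOne, ← lmul_oneTmul, ← lmul_mul_right hA2, ← lmul_mul_right hA2, coverL_mul,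
    coverR_mul, lmul_tmulOne, lmul_oneTmul]
  generalize lmul (H.Δ b) z = w
  induction w with
  | zero => simp
  | add x y hx hy => simp only [map_add, hx, hy]
  | tmul p q => simp

/-- `(ε ⊗ ι)((1 ⊗ a) Δ(b)) = a b`. -/
lemma sliceL_coverR (a b : A) : sliceL H.counit (H.coverR (a ⊗ₜ b)) = a * b := by
  refine H.nondegenerate.eq_of_mul_right fun d => ?_
  obtain ⟨T₁, -, h1, -⟩ := H.isMultiplierHopf.2
  have hA2 := H.nondegenerate.tensor H.nondegenerate
  have h : (LinearMap.mulRight ℂ d).lTensor A (H.coverR (a ⊗ₜ b)) =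
      (LinearMap.mulLeft ℂ a).lTensor A (T₁ (b ⊗ₜ d)) := by
    refine hA2.eq_of_mul_left fun z => ?_
    refine hA2.eq_of_mul_right fun z' => ?_
    have h2 : T₁ (b ⊗ₜ d) * z' = lmul (H.Δ b) (lmul (oneTmul d) z') :=
      congrArg (fun m => lmul m z') (h1 b d)
    rw [← rmul_oneTmul, ← lmul_oneTmul, mul_assoc, mul_assoc, ← mul_lmul, coverR_mul,
      ← lmul_oneTmul, ← lmul_mul_right hA2, h2]
  have h' := congrArg (sliceL H.counit) h
  rw [sliceL_lTensor, sliceL_lTensor, H.isCounit.left b d _ (h1 b d)] at h'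
  simpa [mul_assoc] using h'

/-- `b₁ S(a b₂) = ε(b) S(a)`. -/
lemma mul_antipode_coverR (a b : A) :
    LinearMap.mul' ℂ A (H.antipode.toLinearMap.lTensor A (H.coverR (a ⊗ₜ b))) =
      H.counit b • H.antipode a := by
  refine H.nondegenerate.eq_of_mul_left fun d => ?_
  have e1 : ∀ w : A ⊗[ℂ] A, LinearMap.mul' ℂ A (H.antipode.toLinearMap.lTensor A
      ((LinearMap.mulLeft ℂ d).rTensor A w)) =
        d * LinearMap.mul' ℂ A (H.antipode.toLinearMap.lTensor A w) := by
    intro w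
    induction w with
    | zero => simp
    | add x y hx hy => simp only [map_add, mul_add, hx, hy]
    | tmul p q => simp [mul_assoc]
  have e2 : ∀ w : A ⊗[ℂ] A, LinearMap.mul' ℂ A (H.antipode.toLinearMap.lTensor A
      ((LinearMap.mulLeft ℂ a).lTensor A w)) =
        LinearMap.mul' ℂ A (H.antipode.toLinearMap.lTensor A w) * H.antipode a := by
    intro w
    induction w with
    | zero => simp
    | add x y hx hy => simp only [map_add, add_mul, hx, hy]
    | tmul p q => simp [mul_assoc, H.antipode_mul]
  rw [← e1, mulLeft_coverR, e2, mul_antipode_coverL, smul_mul_assoc, mul_smul_comm]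

/-- `b₂ S⁻¹(S(a) b₁) = ε(b) a`. -/
lemma mul_antipode_symm_coverL (a b : A) :
    LinearMap.mul' ℂ A (TensorProduct.comm ℂ A A (H.antipode.symm.toLinearMap.rTensor A
      (H.coverL (H.antipode a ⊗ₜ b)))) = H.counit b • a := by
  apply H.antipode.injective
  have e : ∀ w : A ⊗[ℂ] A, H.antipode (LinearMap.mul' ℂ A (TensorProduct.comm ℂ A A
      (H.antipode.symm.toLinearMap.rTensor A w))) =
        LinearMap.mul' ℂ A (H.antipode.toLinearMap.lTensor A w) := by
    intro w
    induction w with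
    | zero => simp
    | add x y hx hy => simp only [map_add, hx, hy]
    | tmul p q => simp [H.antipode_mul]
  rw [e, mul_antipode_coverL, map_smul]

/-! ### The hexagon identities in covered form -/

variable {H} {R : M (A ⊗[ℂ] A)}

/-- With `R (a ⊗ 1) = ∑ x¹ ⊗ x²`, this is `(ι ⊗ Δ)(R) = R¹³ R¹²` multiplied by `1 ⊗ s ⊗ 1` on the
left and by `a ⊗ Δ(q)` on the right, so that both sides lie in `A ⊗ A ⊗ A`. -/
lemma IsRMatrix.leg13_coverL (hR : H.IsRMatrix R) {a : A} {x : A ⊗[ℂ] M A}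
    (hx : emb x = R * tmulOne a) (s q : A) :
    lmul (leg13 R) ((TensorProduct.assoc ℂ A A A).symm
      ((H.coverL ∘ₗ (TensorProduct.mk ℂ A A).flip q ∘ₗ rmulAt A s).lTensor A x)) =
    (TensorProduct.assoc ℂ A A A).symm
      ((H.coverL ∘ₗ TensorProduct.mk ℂ A A s ∘ₗ lmulAt A q).lTensor A x) := by
  have hA := H.nondegenerate
  refine eq_of_mul_tmul_tmul hA fun p z₁ z₂ => ?_
  rw [← lmul_mul_right ((hA.tensor hA).tensor hA)]
  have e1 : ∀ y : A ⊗[ℂ] M A, (TensorProduct.assoc ℂ A A A).symm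
      ((H.coverL ∘ₗ (TensorProduct.mk ℂ A A).flip q ∘ₗ rmulAt A s).lTensor A y) *
        ((p ⊗ₜ z₁) ⊗ₜ z₂) =
      midMul A s (lmul (leg12 (emb y)) ((TensorProduct.assoc ℂ A A A).symm
        (p ⊗ₜ lmul (H.Δ q) (z₁ ⊗ₜ z₂)))) := by
    intro y
    induction y with
    | zero => simp [leg12, lmul_zero]
    | add x y hx hy =>
      simp only [map_add, add_mul, hx, hy, leg12, TensorProduct.add_tmul, lmul_add]
    | tmul y m =>
      simp only [LinearMap.lTensor_tmul, LinearMap.comp_apply, LinearMap.flip_apply,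
        TensorProduct.mk_apply, rmulAt_apply, assoc_symm_tmul_mul, coverL_mul]
      generalize lmul (H.Δ q) (z₁ ⊗ₜ z₂) = w
      induction w with
      | zero => simp
      | add x y hx hy => simp only [map_add, TensorProduct.tmul_add, hx, hy]
      | tmul u v => simp [lmul_leg12_tmul, emb, mul_lmul]
  have e2 : ∀ y : A ⊗[ℂ] M A, midMul A s (lmul (H.comulR ((lmulAt A q).lTensor A y))
      ((p ⊗ₜ z₁) ⊗ₜ z₂)) = (TensorProduct.assoc ℂ A A A).symm
      ((H.coverL ∘ₗ TensorProduct.mk ℂ A A s ∘ₗ lmulAt A q).lTensor A y) *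
        ((p ⊗ₜ z₁) ⊗ₜ z₂) := by
    intro y
    induction y with
    | zero => simp only [map_zero, zero_mul]; exact map_zero (midMul A s)
    | add x y hx hy => simp only [map_add, add_mul, lmul_add, hx, hy]
    | tmul y m =>
      simp only [LinearMap.lTensor_tmul, LinearMap.comp_apply, TensorProduct.mk_apply,
        lmulAt_apply, assoc_symm_tmul_mul, coverL_mul, ← midMul_assoc_symm]
      rfl
  have e3 : lmul (leg12 (tmulOne a)) ((TensorProduct.assoc ℂ A A A).symm
      (p ⊗ₜ lmul (H.Δ q) (z₁ ⊗ₜ z₂))) = lmul (H.comulR (a ⊗ₜ q)) ((p ⊗ₜ z₁) ⊗ₜ z₂) := by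
    have : lmul (H.comulR (a ⊗ₜ q)) ((p ⊗ₜ z₁) ⊗ₜ z₂) = (TensorProduct.assoc ℂ A A A).symm
      ((a * p) ⊗ₜ lmul (H.Δ q) (z₁ ⊗ₜ z₂)) := rfl
    rw [this]
    generalize lmul (H.Δ q) (z₁ ⊗ₜ z₂) = w
    induction w with
    | zero => simp
    | add x y hx hy => simp only [map_add, TensorProduct.tmul_add, hx, hy]
    | tmul u v => simp [lmul_leg12_tmul, lmul_tmulOne]
  rw [e1, hx, leg12_mul, lmul_mul, e3, leg13_midMul, ← e2, ← lmul_tmul_of_emb hA hx,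
    ← (hR.comul_right (a ⊗ₜ q)).1]
  rfl

/-- With `(c ⊗ 1) R = ∑ y¹ ⊗ y²`, this is `(Δ ⊗ ι)(R) = R¹³ R²³` multiplied by `1 ⊗ c ⊗ 1` on the
left and by `Δ(p) ⊗ b` on the right, so that both sides lie in `A ⊗ A ⊗ A`. -/
lemma IsRMatrix.leg13_coverR (hR : H.IsRMatrix R) {c : A} {y : A ⊗[ℂ] M A}
    (hy : emb y = tmulOne c * R) (p b : A) :
    lmul (leg13 R) (TensorProduct.map (H.coverR ∘ₗ (TensorProduct.mk ℂ A A).flip p)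
      (lmulAt A b) y) =
    (H.coverR ∘ₗ TensorProduct.mk ℂ A A c).rTensor A (lmul R (p ⊗ₜ b)) := by
  have hA := H.nondegenerate
  refine eq_of_mul_tmul_tmul hA fun z₁ z₂ v => ?_
  rw [← lmul_mul_right ((hA.tensor hA).tensor hA)]
  have e1 : ∀ x : A ⊗[ℂ] M A, TensorProduct.map
      (H.coverR ∘ₗ (TensorProduct.mk ℂ A A).flip p) (lmulAt A b) x * ((z₁ ⊗ₜ z₂) ⊗ₜ v) =
      lmul (leg23 (emb x)) (lmul (H.comulL (p ⊗ₜ b)) ((z₁ ⊗ₜ z₂) ⊗ₜ v)) := by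
    intro x
    have : lmul (H.comulL (p ⊗ₜ b)) ((z₁ ⊗ₜ z₂) ⊗ₜ v) =
      lmul (H.Δ p) (z₁ ⊗ₜ z₂) ⊗ₜ (b * v) := rfl
    rw [this]
    induction x with
    | zero => simp [leg23, lmul_zero]
    | add x y hx hy =>
      simp only [map_add, add_mul, hx, hy, leg23, TensorProduct.tmul_add, lmul_add]
    | tmul y m =>
      simp only [TensorProduct.map_tmul, LinearMap.comp_apply, LinearMap.flip_apply,
        TensorProduct.mk_apply, lmulAt_apply, Algebra.TensorProduct.tmul_mul_tmul, coverR_mul]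
      generalize lmul (H.Δ p) (z₁ ⊗ₜ z₂) = w
      induction w with
      | zero => simp
      | add x y hx hy => simp only [map_add, TensorProduct.add_tmul, hx, hy]
      | tmul u v => simp [lmul_leg23, emb, lmul_mul_right hA]
  have e2 : ∀ w : A ⊗[ℂ] A, midMul A c (lmul (H.comulL w) ((z₁ ⊗ₜ z₂) ⊗ₜ v)) =
      (H.coverR ∘ₗ TensorProduct.mk ℂ A A c).rTensor A w * ((z₁ ⊗ₜ z₂) ⊗ₜ v) := by
    intro w
    induction w with
    | zero => simp only [map_zero, zero_mul]; exact map_zero (midMul A c)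
    | add x y hx hy => simp only [map_add, add_mul, lmul_add, hx, hy]
    | tmul h k =>
      simp only [LinearMap.rTensor_tmul, LinearMap.comp_apply, TensorProduct.mk_apply,
        Algebra.TensorProduct.tmul_mul_tmul, coverR_mul]
      rfl
  rw [e1, hy, lmul_leg23_tmulOne_mul, leg13_midMul, ← e2, ← (hR.comul_left (p ⊗ₜ b)).1]
  rfl

end RegularMultiplierHopfAlgebra


namespace RegularMultiplierHopfAlgebra

variable {A : Type*} [NonUnitalRing A] [Module ℂ A] [IsScalarTower ℂ A A] [SMulCommClass ℂ A A]
  {H : RegularMultiplierHopfAlgebra A}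

/-! ### The counit on the legs of an R-matrix -/

lemma exists_counit_eq_one (H : RegularMultiplierHopfAlgebra A) [Nontrivial A] :
    ∃ e, H.counit e = 1 := by
  obtain ⟨T₁, -, h1, -⟩ := H.isMultiplierHopf.2
  refine exists_one H.nondegenerate (T₁ := T₁)
    (fun a b => H.isCounit.left a b _ (h1 a b)) fun h => ?_
  obtain ⟨x, hx⟩ := exists_ne (0 : A)
  exact hx (h x)

lemma sliceL_counit_mul (H : RegularMultiplierHopfAlgebra A) (w z : A ⊗[ℂ] A) :
    sliceL H.counit (w * z) = sliceL H.counit w * sliceL H.counit z := by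
  induction w with
  | zero => simp
  | add x y hx hy => simp only [map_add, add_mul, hx, hy]
  | tmul a b =>
    induction z with
    | zero => simp
    | add x y hx hy => simp only [map_add, mul_add, hx, hy]
    | tmul c d => simp [H.isCounit.map_mul, smul_mul_smul_comm]

lemma sliceR_counit_mul (H : RegularMultiplierHopfAlgebra A) (w z : A ⊗[ℂ] A) :
    sliceR H.counit (w * z) = sliceR H.counit w * sliceR H.counit z := by
  induction w with
  | zero => simp
  | add x y hx hy => simp only [map_add, add_mul, hx, hy]
  | tmul a b =>
    induction z with
    | zero => simp
    | add x y hx hy => simp only [map_add, mul_add, hx, hy]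
    | tmul c d => simp [H.isCounit.map_mul, smul_mul_smul_comm]

/-- For a surjective homomorphism onto a non-degenerate algebra, being trivial on a multiplier can
be checked on left multiplications. -/
lemma extends_one_of_lmul {B : Type*} [NonUnitalRing B] [Module ℂ B] [IsScalarTower ℂ B B]
    [SMulCommClass ℂ B B] (hA : Nondegenerate A) {f : B →ₗ[ℂ] A}
    (hf : ∀ x y, f (x * y) = f x * f y) (hs : Function.Surjective f) {m : M B}
    (h : ∀ x, f (lmul m x) = f x) : Extends (inc A ∘ₗ f) m 1 := by
  refine fun w => ⟨by simp [h], ?_⟩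
  have : f (rmul m w) = f w := by
    refine hA.eq_of_mul_right fun c => ?_
    obtain ⟨z, rfl⟩ := hs c
    rw [← hf, ← mul_lmul, hf, h]
  simp [this]

lemma lmul_unit_surjective {B : Type*} [NonUnitalRing B] [Module ℂ B] [IsScalarTower ℂ B B]
    [SMulCommClass ℂ B B] {m : M B} (hm : IsUnit m) : Function.Surjective (lmul m) := by
  obtain ⟨m, rfl⟩ := hm
  intro w
  refine ⟨lmul (↑m⁻¹ : M B) w, ?_⟩
  rw [← lmul_mul, Units.mul_inv, lmul_one]

variable {R : M (A ⊗[ℂ] A)}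

/-- `(ε ⊗ ι)(R) = 1`: both `(ε ⊗ ι)(R)` and `1` are solutions `N` of
`(1 ⊗ N) R = (ε ⊗ ι ⊗ ι)((Δ ⊗ ι)(R)) = R`, and `R` is invertible. -/
lemma IsRMatrix.sliceL_counit_lmul [Nontrivial A] (hR : H.IsRMatrix R) (w : A ⊗[ℂ] A) :
    sliceL H.counit (lmul R w) = sliceL H.counit w := by
  have hA := H.nondegenerate
  obtain ⟨e, he⟩ := H.exists_counit_eq_one
  let N : A →ₗ[ℂ] A := sliceL H.counit ∘ₗ lmul R ∘ₗ TensorProduct.mk ℂ A A e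
  obtain ⟨ye, hye⟩ := hR.mem_mul e
  have hε : ∀ z : A ⊗[ℂ] A, sliceL H.counit (lmul (tmulOne e) z) = sliceL H.counit z := by
    intro z
    induction z with
    | zero => simp
    | add x y hx hy => simp only [map_add, hx, hy]
    | tmul a b => simp [lmul_tmulOne, H.isCounit.map_mul, he]
  have hp : ∀ (y : A ⊗[ℂ] M A) (p q : A), sliceL H.counit (lmul (emb y) (p ⊗ₜ q)) =
      H.counit p • sliceL H.counit ((lmulAt A q).lTensor A y) := by
    intro y p q
    rw [lmul_emb_tmul]
    generalize (lmulAt A q).lTensor A y = z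
    induction z with
    | zero => simp
    | add x y hx hy => simp only [map_add, smul_add, hx, hy]
    | tmul a b => simp [rmul_tmulOne, H.isCounit.map_mul, smul_smul, mul_comm]
  have hN : ∀ p q, sliceL H.counit (lmul R (p ⊗ₜ q)) = H.counit p • N q := by
    intro p q
    change _ = H.counit p • sliceL H.counit (lmul R (e ⊗ₜ q))
    rw [← hε, ← hε (lmul R (e ⊗ₜ q)), ← lmul_mul, ← lmul_mul, ← hye, hp, hp, he, one_smul]
  -- `F` is `ε ⊗ ι ⊗ ι`
  let F : (A ⊗[ℂ] A) ⊗[ℂ] A →ₗ[ℂ] A ⊗[ℂ] A := (sliceL H.counit).rTensor A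
  have hF : ∀ v, F (lmul (leg13 R) v) = N.lTensor A (F v) := by
    intro v
    induction v with
    | zero => simp
    | add x y hx hy => simp only [map_add, hx, hy]
    | tmul v t =>
      induction v with
      | zero => simp
      | add x y hx hy => simp only [map_add, TensorProduct.add_tmul, hx, hy]
      | tmul p s =>
        have aux : ∀ z : A ⊗[ℂ] A, F (TensorProduct.rightComm ℂ A A A (z ⊗ₜ s)) =
            s ⊗ₜ sliceL H.counit z := by
          intro z
          induction z with
          | zero => simp
          | add x y hx hy => simp only [map_add, TensorProduct.add_tmul, TensorProduct.tmul_add,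
              hx, hy]
          | tmul a b => simp [F, TensorProduct.smul_tmul]
        rw [lmul_leg13_tmul, aux, hN]
        simp [F, TensorProduct.smul_tmul]
  have fix : ∀ c p b : A, N.lTensor A (lmul (tmulOne c) (lmul R (p ⊗ₜ b))) =
      lmul (tmulOne c) (lmul R (p ⊗ₜ b)) := by
    intro c p b
    obtain ⟨y, hy⟩ := hR.mem_mul c
    have h := congrArg F (hR.leg13_coverR hy p b)
    have e1 : ∀ x : A ⊗[ℂ] M A, F (TensorProduct.map
        (H.coverR ∘ₗ (TensorProduct.mk ℂ A A).flip p) (lmulAt A b) x) =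
          lmul (emb x) (p ⊗ₜ b) := by
      intro x
      rw [lmul_emb_tmul]
      induction x with
      | zero => simp
      | add x y hx hy => simp only [map_add, hx, hy]
      | tmul a m => simp [F, sliceL_coverR, rmul_tmulOne]
    have e2 : ∀ z : A ⊗[ℂ] A, F ((H.coverR ∘ₗ TensorProduct.mk ℂ A A c).rTensor A z) =
        lmul (tmulOne c) z := by
      intro z
      induction z with
      | zero => simp
      | add x y hx hy => simp only [map_add, hx, hy]
      | tmul a m => simp [F, sliceL_coverR, lmul_tmulOne]
    rwa [hF, e1, e2, hy, lmul_mul] at h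
  have fix' : ∀ z : A ⊗[ℂ] A, N.lTensor A z = z := by
    intro z
    refine eq_of_rTensor (fun a : A => LinearMap.mulLeft ℂ a)
      (fun _ _ => hA.eq_of_mul_left) fun c => ?_
    have comm : (LinearMap.mulLeft ℂ c).rTensor A (N.lTensor A z) =
        N.lTensor A ((LinearMap.mulLeft ℂ c).rTensor A z) := by
      rw [← LinearMap.comp_apply, ← LinearMap.comp_apply, LinearMap.rTensor_comp_lTensor,
        LinearMap.lTensor_comp_rTensor]
    rw [comm]
    clear comm
    obtain ⟨v, rfl⟩ := lmul_unit_surjective hR.isUnit z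
    induction v with
    | zero => simp
    | add x y hx hy => simp only [map_add, hx, hy]
    | tmul p b => exact fix c p b
  induction w with
  | zero => simp
  | add x y hx hy => simp only [map_add, hx, hy]
  | tmul p q =>
    have h := congrArg (sliceL H.counit) (fix' (e ⊗ₜ q))
    simp only [LinearMap.lTensor_tmul, sliceL_tmul, he, one_smul] at h
    rw [hN, h, sliceL_tmul]

/-- `(ι ⊗ ε)(R) = 1`: both `(ι ⊗ ε)(R)` and `1` are solutions `N` of
`(N ⊗ 1) R = (ι ⊗ ι ⊗ ε)((ι ⊗ Δ)(R)) = R`, and `R` is invertible. -/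
lemma IsRMatrix.sliceR_counit_lmul [Nontrivial A] (hR : H.IsRMatrix R) (w : A ⊗[ℂ] A) :
    sliceR H.counit (lmul R w) = sliceR H.counit w := by
  have hA := H.nondegenerate
  obtain ⟨e, he⟩ := H.exists_counit_eq_one
  let N : A →ₗ[ℂ] A := sliceR H.counit ∘ₗ lmul R ∘ₗ (TensorProduct.mk ℂ A A).flip e
  -- `ε` is multiplicative on `M(A)`: `ε(m q) = ε(e m q) = ε(e m) ε(q) = ε(m e) ε(q)`
  have hε : ∀ (m : M A) (q : A), H.counit (lmul m q) = H.counit (lmul m e) * H.counit q := by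
    intro m q
    have h : ∀ q, H.counit (lmul m q) = H.counit (rmul m e) * H.counit q := fun q => by
      rw [← H.isCounit.map_mul, ← mul_lmul, H.isCounit.map_mul, he, one_mul]
    rw [h q, h e, he, mul_one]
  have hN : ∀ p q, sliceR H.counit (lmul R (p ⊗ₜ q)) = H.counit q • N p := by
    intro p q
    obtain ⟨x, hx⟩ := hR.mul_mem p
    change _ = H.counit q • sliceR H.counit (lmul R (p ⊗ₜ e))
    rw [lmul_tmul_of_emb hA hx, lmul_tmul_of_emb hA hx]
    clear hx
    induction x with
    | zero => simp
    | add x y hx hy => simp only [map_add, smul_add, hx, hy]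
    | tmul a m => simp [hε m q, smul_smul, mul_comm]
  -- `F` is `ι ⊗ ι ⊗ ε`
  let F : (A ⊗[ℂ] A) ⊗[ℂ] A →ₗ[ℂ] A ⊗[ℂ] A :=
    (sliceR H.counit).lTensor A ∘ₗ (TensorProduct.assoc ℂ A A A).toLinearMap
  have hF : ∀ v, F (lmul (leg13 R) v) = N.rTensor A (F v) := by
    intro v
    induction v with
    | zero => simp
    | add x y hx hy => simp only [map_add, hx, hy]
    | tmul v t =>
      induction v with
      | zero => simp
      | add x y hx hy => simp only [map_add, TensorProduct.add_tmul, hx, hy]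
      | tmul p s =>
        have aux : ∀ z : A ⊗[ℂ] A, F (TensorProduct.rightComm ℂ A A A (z ⊗ₜ s)) =
            sliceR H.counit z ⊗ₜ s := by
          intro z
          induction z with
          | zero => simp
          | add x y hx hy => simp only [map_add, TensorProduct.add_tmul, hx, hy]
          | tmul a b => simp [F, TensorProduct.smul_tmul]
        rw [lmul_leg13_tmul, aux, hN]
        simp [F, TensorProduct.smul_tmul]
  have fix : ∀ s a q : A, N.rTensor A (lmul (oneTmul s) (lmul R (a ⊗ₜ q))) =
      lmul (oneTmul s) (lmul R (a ⊗ₜ q)) := by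
    intro s a q
    obtain ⟨x, hx⟩ := hR.mul_mem a
    have h := congrArg F (hR.leg13_coverL hx s q)
    have e1 : ∀ x : A ⊗[ℂ] M A, F ((TensorProduct.assoc ℂ A A A).symm
        ((H.coverL ∘ₗ (TensorProduct.mk ℂ A A).flip q ∘ₗ rmulAt A s).lTensor A x)) =
          lmul (oneTmul s) ((lmulAt A q).lTensor A x) := by
      intro x
      induction x with
      | zero => simp
      | add x y hx hy => simp only [map_add, hx, hy]
      | tmul a m => simp [F, sliceR_coverL, lmul_oneTmul, mul_lmul]
    have e2 : ∀ x : A ⊗[ℂ] M A, F ((TensorProduct.assoc ℂ A A A).symm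
        ((H.coverL ∘ₗ TensorProduct.mk ℂ A A s ∘ₗ lmulAt A q).lTensor A x)) =
          lmul (oneTmul s) ((lmulAt A q).lTensor A x) := by
      intro x
      induction x with
      | zero => simp
      | add x y hx hy => simp only [map_add, hx, hy]
      | tmul a m => simp [F, sliceR_coverL, lmul_oneTmul]
    rwa [hF, e1, e2, ← lmul_tmul_of_emb hA hx] at h
  have fix' : ∀ z : A ⊗[ℂ] A, N.rTensor A z = z := by
    intro z
    refine eq_of_lTensor (fun a : A => LinearMap.mulLeft ℂ a)
      (fun _ _ => hA.eq_of_mul_left) fun c => ?_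
    have comm : (LinearMap.mulLeft ℂ c).lTensor A (N.rTensor A z) =
        N.rTensor A ((LinearMap.mulLeft ℂ c).lTensor A z) := by
      rw [← LinearMap.comp_apply, ← LinearMap.comp_apply, LinearMap.rTensor_comp_lTensor,
        LinearMap.lTensor_comp_rTensor]
    rw [comm]
    clear comm
    obtain ⟨v, rfl⟩ := lmul_unit_surjective hR.isUnit z
    induction v with
    | zero => simp
    | add x y hx hy => simp only [map_add, hx, hy]
    | tmul p b => exact fix c p b
  induction w with
  | zero => simp
  | add x y hx hy => simp only [map_add, hx, hy]
  | tmul p q =>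
    have h := congrArg (sliceR H.counit) (fix' (p ⊗ₜ e))
    simp only [LinearMap.rTensor_tmul, sliceR_tmul, he, one_smul] at h
    rw [hN, h, sliceR_tmul]

lemma sliceL_counit_surjective (H : RegularMultiplierHopfAlgebra A) [Nontrivial A] :
    Function.Surjective (sliceL H.counit) := by
  obtain ⟨e, he⟩ := H.exists_counit_eq_one
  exact fun a => ⟨e ⊗ₜ a, by simp [he]⟩

lemma sliceR_counit_surjective (H : RegularMultiplierHopfAlgebra A) [Nontrivial A] :
    Function.Surjective (sliceR H.counit) := by
  obtain ⟨e, he⟩ := H.exists_counit_eq_one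
  exact fun a => ⟨a ⊗ₜ e, by simp [he]⟩

lemma IsRMatrix.extends_counitL [Nontrivial A] (hR : H.IsRMatrix R) : Extends H.counitL R 1 :=
  extends_one_of_lmul H.nondegenerate H.sliceL_counit_mul H.sliceL_counit_surjective
    hR.sliceL_counit_lmul

lemma IsRMatrix.extends_counitR [Nontrivial A] (hR : H.IsRMatrix R) : Extends H.counitR R 1 :=
  extends_one_of_lmul H.nondegenerate H.sliceR_counit_mul H.sliceR_counit_surjective
    hR.sliceR_counit_lmul

end RegularMultiplierHopfAlgebra


namespace RegularMultiplierHopfAlgebra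

variable {A : Type*} [NonUnitalRing A] [Module ℂ A] [IsScalarTower ℂ A A] [SMulCommClass ℂ A A]
  {H : RegularMultiplierHopfAlgebra A} {R : M (A ⊗[ℂ] A)}

/-! ### The inverse of an R-matrix -/

/-- `R R⁻¹ = 1` for `R⁻¹ = (ι ⊗ S⁻¹)(R)`: apply `p ⊗ s ⊗ t ↦ p ⊗ t S⁻¹(s)` to
`(ι ⊗ Δ)(R) = R¹³ R¹²`. -/
lemma IsRMatrix.mul_emb_antipodeInvM [Nontrivial A] (hR : H.IsRMatrix R) {a : A}
    {x : A ⊗[ℂ] M A} (hx : emb x = R * tmulOne a) :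
    R * emb (TensorProduct.map LinearMap.id H.antipodeInvM x) = tmulOne a := by
  have hA := H.nondegenerate
  have hA2 := hA.tensor hA
  obtain ⟨e, he⟩ := H.exists_counit_eq_one
  let F : (A ⊗[ℂ] A) ⊗[ℂ] A →ₗ[ℂ] A ⊗[ℂ] A :=
    (LinearMap.mul' ℂ A ∘ₗ (TensorProduct.comm ℂ A A).toLinearMap ∘ₗ
      H.antipode.symm.toLinearMap.rTensor A).lTensor A ∘ₗ
      (TensorProduct.assoc ℂ A A A).toLinearMap
  have hF : ∀ v, F (lmul (leg13 R) v) = lmul R (F v) := by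
    intro v
    induction v with
    | zero => simp
    | add x y hx hy => simp only [map_add, hx, hy]
    | tmul v t =>
      induction v with
      | zero => simp
      | add x y hx hy => simp only [map_add, TensorProduct.add_tmul, hx, hy]
      | tmul p s =>
        have aux : ∀ z : A ⊗[ℂ] A, F (TensorProduct.rightComm ℂ A A A (z ⊗ₜ s)) =
            rmul (oneTmul (H.antipode.symm s)) z := by
          intro z
          induction z with
          | zero => simp
          | add x y hx hy => simp only [map_add, TensorProduct.add_tmul, hx, hy]
          | tmul a b => simp [F, rmul_oneTmul]
        rw [lmul_leg13_tmul, aux, ← lmul_rmul_comm hA2]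
        simp [F, rmul_oneTmul]
  have key : ∀ b, lmul R ((lmulAt A b).lTensor A
      (TensorProduct.map LinearMap.id H.antipodeInvM x)) = a ⊗ₜ b := by
    intro b
    have h := congrArg F (hR.leg13_coverL hx (H.antipode b) e)
    have e1 : ∀ x : A ⊗[ℂ] M A, F ((TensorProduct.assoc ℂ A A A).symm
        ((H.coverL ∘ₗ (TensorProduct.mk ℂ A A).flip e ∘ₗ rmulAt A (H.antipode b)).lTensor A x)) =
          (lmulAt A b).lTensor A (TensorProduct.map LinearMap.id H.antipodeInvM x) := by
      intro x
      induction x with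
      | zero => simp
      | add x y hx hy => simp only [map_add, hx, hy]
      | tmul a m =>
        have h := H.mul_antipode_symm_coverL (H.antipode.symm (rmul m (H.antipode b))) e
        rw [LinearEquiv.apply_symm_apply] at h
        simp [F, h, he, antipodeInvM, antiExt]
    have e2 : ∀ x : A ⊗[ℂ] M A, F ((TensorProduct.assoc ℂ A A A).symm
        ((H.coverL ∘ₗ TensorProduct.mk ℂ A A (H.antipode b) ∘ₗ lmulAt A e).lTensor A x)) =
          sliceR H.counit ((lmulAt A e).lTensor A x) ⊗ₜ b := by
      intro x
      induction x with
      | zero => simp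
      | add x y hx hy => simp only [map_add, TensorProduct.add_tmul, hx, hy]
      | tmul a m => simp [F, mul_antipode_symm_coverL, TensorProduct.smul_tmul]
    rwa [hF, e1, e2, ← lmul_tmul_of_emb hA hx, hR.sliceR_counit_lmul, sliceR_tmul, he,
      one_smul] at h
  refine ext_lmul hA2 fun w => ?_
  induction w with
  | zero => simp
  | add x y hx hy => simp only [map_add, hx, hy]
  | tmul p b =>
    rw [lmul_mul, lmul_emb_tmul, lmul_rmul_comm hA2, key]
    simp [rmul_tmulOne, lmul_tmulOne]

/-- `R R⁻¹ = 1` for `R⁻¹ = (S ⊗ ι)(R)`: apply `s ⊗ t ⊗ v ↦ s S(t) ⊗ v` to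
`(Δ ⊗ ι)(R) = R¹³ R²³`. -/
lemma IsRMatrix.mul_emb_antipode [Nontrivial A] (hR : H.IsRMatrix R) {c : A}
    {y : A ⊗[ℂ] M A} (hy : emb y = tmulOne c * R) :
    R * emb (TensorProduct.map H.antipode.toLinearMap LinearMap.id y) =
      tmulOne (H.antipode c) := by
  have hA := H.nondegenerate
  have hA2 := hA.tensor hA
  obtain ⟨e, he⟩ := H.exists_counit_eq_one
  let F : (A ⊗[ℂ] A) ⊗[ℂ] A →ₗ[ℂ] A ⊗[ℂ] A :=
    (LinearMap.mul' ℂ A ∘ₗ H.antipode.toLinearMap.lTensor A).rTensor A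
  have hF : ∀ v, F (lmul (leg13 R) v) = lmul R (F v) := by
    intro v
    induction v with
    | zero => simp
    | add x y hx hy => simp only [map_add, hx, hy]
    | tmul v t =>
      induction v with
      | zero => simp
      | add x y hx hy => simp only [map_add, TensorProduct.add_tmul, hx, hy]
      | tmul p s =>
        have aux : ∀ z : A ⊗[ℂ] A, F (TensorProduct.rightComm ℂ A A A (z ⊗ₜ s)) =
            rmul (tmulOne (H.antipode s)) z := by
          intro z
          induction z with
          | zero => simp
          | add x y hx hy => simp only [map_add, TensorProduct.add_tmul, hx, hy]
          | tmul a b => simp [F, rmul_tmulOne]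
        rw [lmul_leg13_tmul, aux, ← lmul_rmul_comm hA2]
        simp [F, rmul_tmulOne]
  have key : ∀ b, lmul R ((lmulAt A b).lTensor A
      (TensorProduct.map H.antipode.toLinearMap LinearMap.id y)) = H.antipode c ⊗ₜ b := by
    intro b
    have h := congrArg F (hR.leg13_coverR hy e b)
    have e1 : ∀ x : A ⊗[ℂ] M A, F (TensorProduct.map
        (H.coverR ∘ₗ (TensorProduct.mk ℂ A A).flip e) (lmulAt A b) x) =
          (lmulAt A b).lTensor A
            (TensorProduct.map H.antipode.toLinearMap LinearMap.id x) := by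
      intro x
      induction x with
      | zero => simp
      | add x y hx hy => simp only [map_add, hx, hy]
      | tmul a m => simp [F, mul_antipode_coverR, he]
    have e2 : ∀ z : A ⊗[ℂ] A, F ((H.coverR ∘ₗ TensorProduct.mk ℂ A A c).rTensor A z) =
        H.antipode c ⊗ₜ sliceL H.counit z := by
      intro z
      induction z with
      | zero => simp
      | add x y hx hy => simp only [map_add, TensorProduct.tmul_add, hx, hy]
      | tmul a m => simp [F, mul_antipode_coverR, TensorProduct.smul_tmul]
    rwa [hF, e1, e2, hR.sliceL_counit_lmul, sliceL_tmul, he, one_smul] at h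
  refine ext_lmul hA2 fun w => ?_
  induction w with
  | zero => simp
  | add x y hx hy => simp only [map_add, hx, hy]
  | tmul p b =>
    rw [lmul_mul, lmul_emb_tmul, lmul_rmul_comm hA2, key]
    simp [rmul_tmulOne, lmul_tmulOne]

section Inverse

variable {R : (M (A ⊗[ℂ] A))ˣ} [Nontrivial A]

lemma IsRMatrix.inv_mul_tmulOne (hR : H.IsRMatrix (R : M (A ⊗[ℂ] A))) {a : A} {x : A ⊗[ℂ] M A}
    (hx : emb x = (R : M (A ⊗[ℂ] A)) * tmulOne a) :
    (↑R⁻¹ : M (A ⊗[ℂ] A)) * tmulOne a =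
      emb (TensorProduct.map LinearMap.id H.antipodeInvM x) := by
  rw [← hR.mul_emb_antipodeInvM hx, Units.inv_mul_cancel_left]

lemma IsRMatrix.inv_mul_tmulOne_antipode (hR : H.IsRMatrix (R : M (A ⊗[ℂ] A))) {c : A}
    {y : A ⊗[ℂ] M A} (hy : emb y = tmulOne c * (R : M (A ⊗[ℂ] A))) :
    (↑R⁻¹ : M (A ⊗[ℂ] A)) * tmulOne (H.antipode c) =
      emb (TensorProduct.map H.antipode.toLinearMap LinearMap.id y) := by
  rw [← hR.mul_emb_antipode hy, Units.inv_mul_cancel_left]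

lemma IsRMatrix.tmulOne_mul_inv (hR : H.IsRMatrix (R : M (A ⊗[ℂ] A))) {c : A} {y : A ⊗[ℂ] M A}
    (hy : emb y = tmulOne c * (R : M (A ⊗[ℂ] A))) :
    tmulOne c * (↑R⁻¹ : M (A ⊗[ℂ] A)) =
      emb (TensorProduct.map LinearMap.id H.antipodeInvM y) := by
  refine eq_of_mul_tmulOne H.nondegenerate fun a => ?_
  obtain ⟨x, hx⟩ := hR.mul_mem a
  have h := congrArg (TensorProduct.map LinearMap.id H.antipodeInvM)
    (map_mulLeft_eq_map_mulRight H.nondegenerate hx hy)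
  rw [TensorProduct.map_map, TensorProduct.map_map] at h
  rw [mul_assoc, hR.inv_mul_tmulOne hx, ← emb_map_mulLeft, ← emb_map_mulRight,
    TensorProduct.map_map, TensorProduct.map_map]
  exact congrArg emb h

lemma IsRMatrix.tmulOne_antipode_mul_inv (hR : H.IsRMatrix (R : M (A ⊗[ℂ] A))) {a : A}
    {x : A ⊗[ℂ] M A} (hx : emb x = (R : M (A ⊗[ℂ] A)) * tmulOne a) :
    tmulOne (H.antipode a) * (↑R⁻¹ : M (A ⊗[ℂ] A)) =
      emb (TensorProduct.map H.antipode.toLinearMap LinearMap.id x) := by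
  refine eq_of_mul_tmulOne H.nondegenerate fun d => ?_
  obtain ⟨c, rfl⟩ := H.antipode.surjective d
  obtain ⟨y, hy⟩ := hR.mem_mul c
  have hl : LinearMap.mulLeft ℂ (H.antipode a) ∘ₗ H.antipode.toLinearMap =
      H.antipode.toLinearMap ∘ₗ LinearMap.mulRight ℂ a :=
    LinearMap.ext fun b => by simp [H.antipode_mul]
  have hr : LinearMap.mulRight ℂ (H.antipode c) ∘ₗ H.antipode.toLinearMap =
      H.antipode.toLinearMap ∘ₗ LinearMap.mulLeft ℂ c :=
    LinearMap.ext fun b => by simp [H.antipode_mul]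
  have h := congrArg (TensorProduct.map H.antipode.toLinearMap LinearMap.id)
    (map_mulLeft_eq_map_mulRight H.nondegenerate hx hy)
  rw [TensorProduct.map_map, TensorProduct.map_map] at h
  rw [mul_assoc, hR.inv_mul_tmulOne_antipode hy, ← emb_map_mulLeft, ← emb_map_mulRight,
    TensorProduct.map_map, TensorProduct.map_map, hl, hr]
  exact congrArg emb h.symm

/-- The two formulas for `R⁻¹ (S(c) ⊗ 1)`, compared in `A ⊗ M(A)`: this says that
`R (S(c) ⊗ 1) = (S ⊗ S)((c ⊗ 1) R)`. -/
lemma IsRMatrix.eq_map_antipode (hR : H.IsRMatrix (R : M (A ⊗[ℂ] A))) {c : A}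
    {x y : A ⊗[ℂ] M A} (hx : emb x = (R : M (A ⊗[ℂ] A)) * tmulOne (H.antipode c))
    (hy : emb y = tmulOne c * (R : M (A ⊗[ℂ] A))) :
    TensorProduct.map LinearMap.id H.antipodeInvM x =
      TensorProduct.map H.antipode.toLinearMap LinearMap.id y :=
  emb_injective H.nondegenerate
    ((hR.inv_mul_tmulOne hx).symm.trans (hR.inv_mul_tmulOne_antipode hy))

/-- The two formulas for `(S(a) ⊗ 1) R⁻¹`, compared in `A ⊗ M(A)`: this says that
`(S(a) ⊗ 1) R = (S ⊗ S)(R (a ⊗ 1))`. -/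
lemma IsRMatrix.eq_map_antipode' (hR : H.IsRMatrix (R : M (A ⊗[ℂ] A))) {a : A}
    {x y : A ⊗[ℂ] M A} (hx : emb x = (R : M (A ⊗[ℂ] A)) * tmulOne a)
    (hy : emb y = tmulOne (H.antipode a) * (R : M (A ⊗[ℂ] A))) :
    TensorProduct.map LinearMap.id H.antipodeInvM y =
      TensorProduct.map H.antipode.toLinearMap LinearMap.id x :=
  emb_injective H.nondegenerate
    ((hR.tmulOne_mul_inv hy).symm.trans (hR.tmulOne_antipode_mul_inv hx))

lemma IsRMatrix.antipodeTensorM_eq (hR : H.IsRMatrix (R : M (A ⊗[ℂ] A))) :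
    H.antipodeTensorM (R : M (A ⊗[ℂ] A)) = R := by
  have hA := H.nondegenerate
  refine ext_lmul (hA.tensor hA) fun w => ?_
  induction w with
  | zero => simp
  | add x y hx hy => simp only [map_add, hx, hy]
  | tmul a b =>
    obtain ⟨c, rfl⟩ := H.antipode.surjective a
    obtain ⟨d, rfl⟩ := H.antipode.surjective b
    obtain ⟨x, hx⟩ := hR.mul_mem (H.antipode c)
    obtain ⟨y, hy⟩ := hR.mem_mul c
    have e0 : lmul (H.antipodeTensorM (R : M (A ⊗[ℂ] A))) (H.antipode c ⊗ₜ H.antipode d) =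
        TensorProduct.congr H.antipode H.antipode (rmul (R : M (A ⊗[ℂ] A)) (c ⊗ₜ d)) := by
      simp [antipodeTensorM, antiExt]
      rfl
    have e1 : ∀ z : A ⊗[ℂ] M A, TensorProduct.congr H.antipode H.antipode
        ((rmulAt A d).lTensor A z) = (H.antipode.toLinearMap ∘ₗ rmulAt A d).lTensor A
          (TensorProduct.map H.antipode.toLinearMap LinearMap.id z) := by
      intro z
      induction z with
      | zero => simp
      | add x y hx hy => simp only [map_add, hx, hy]
      | tmul p m => simp
    have e2 : ∀ z : A ⊗[ℂ] M A, (H.antipode.toLinearMap ∘ₗ rmulAt A d).lTensor A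
        (TensorProduct.map LinearMap.id H.antipodeInvM z) =
          (lmulAt A (H.antipode d)).lTensor A z := by
      intro z
      induction z with
      | zero => simp
      | add x y hx hy => simp only [map_add, hx, hy]
      | tmul p m => simp [antipodeInvM, antiExt]
    rw [e0, rmul_tmul_of_emb hA hy, e1, ← hR.eq_map_antipode hx hy, e2, lmul_tmul_of_emb hA hx]

end Inverse

end RegularMultiplierHopfAlgebra

/-! ### Multipliers of the form `∑ S(Q⁽²⁾) Q⁽¹⁾` -/

section Drinfeld

variable {A : Type*} [NonUnitalRing A] [Module ℂ A] [IsScalarTower ℂ A A] [SMulCommClass ℂ A A]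

@[simp] lemma contract_tmul (f : M A →ₗ[ℂ] M A) (g : A →ₗ[ℂ] A) (a : A) (m : M A) :
    contract f g (a ⊗ₜ m) = lmul (f m) (g a) := rfl

/-- The linear map `s ⊗ t ↦ S(t) s`. -/
def antipodeMul (S : A →ₗ[ℂ] A) : A ⊗[ℂ] A →ₗ[ℂ] A :=
  LinearMap.mul' ℂ A ∘ₗ S.rTensor A ∘ₗ (TensorProduct.comm ℂ A A).toLinearMap

@[simp] lemma antipodeMul_tmul (S : A →ₗ[ℂ] A) (s t : A) :
    antipodeMul S (s ⊗ₜ t) = S t * s := by simp [antipodeMul]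

variable {S : A ≃ₗ[ℂ] A} (hS : ∀ x y, S (x * y) = S y * S x)

lemma antipodeMul_lmulAt (b : A) (x : A ⊗[ℂ] M A) :
    antipodeMul S.toLinearMap ((lmulAt A b).lTensor A x) =
      S b * contract (antiExt S hS) LinearMap.id x := by
  induction x with
  | zero => simp
  | add x y hx hy => simp only [map_add, mul_add, hx, hy]
  | tmul a m =>
    simp only [LinearMap.lTensor_tmul, lmulAt_apply, antipodeMul_tmul, contract_tmul,
      LinearMap.id_apply, LinearEquiv.coe_coe]
    change S (lmul m b) * a = S b * S (rmul m (S.symm a))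
    rw [← hS, ← mul_lmul, hS, LinearEquiv.apply_symm_apply]

/-- `S(b) ∑ S(Q⁽²⁾) Q⁽¹⁾ a` is the image of `Q (a ⊗ b)` under `s ⊗ t ↦ S(t) s`. -/
lemma antipodeMul_lmul (hA : Nondegenerate A) {Q : M (A ⊗[ℂ] A)} {X : A →ₗ[ℂ] A ⊗[ℂ] M A}
    (hX : ∀ a, emb (X a) = Q * tmulOne a) (a b : A) :
    antipodeMul S.toLinearMap (lmul Q (a ⊗ₜ b)) =
      S b * contract (antiExt S hS) LinearMap.id (X a) := by
  rw [lmul_tmul_of_emb hA (hX a), antipodeMul_lmulAt]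

/-- If `Q Δ(h) = Δᶜᵒᵖ(h) Q`, then `u = ∑ S(Q⁽²⁾) Q⁽¹⁾` satisfies `u p = S²(p) u`. The hypothesis
gives `∑ S(h₂) u h₁ = ε(h) u`, and `T₁`-preimages of `p ⊗ q` turn this into
`S(q) u p = S(S(p) q) u`. -/
lemma contract_mul_left (hA : Nondegenerate A) {Δ : A →ₗ[ℂ] M (A ⊗[ℂ] A)}
    {T₁ : A ⊗[ℂ] A ≃ₗ[ℂ] A ⊗[ℂ] A}
    (h1 : ∀ a b, inc (A ⊗[ℂ] A) (T₁ (a ⊗ₜ b)) = Δ a * oneTmul b) {ε : A →ₗ[ℂ] ℂ}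
    (s1 : ∀ a b, LinearMap.mul' ℂ A (S.toLinearMap.rTensor A (T₁ (a ⊗ₜ b))) = ε a • b)
    {Q : M (A ⊗[ℂ] A)} (hQ : ∀ h, Q * Δ h = flip (Δ h) * Q) {X : A →ₗ[ℂ] A ⊗[ℂ] M A}
    (hX : ∀ a, emb (X a) = Q * tmulOne a) (p a : A) :
    contract (antiExt S hS) LinearMap.id (X (p * a)) =
      S (S p) * contract (antiExt S hS) LinearMap.id (X a) := by
  let U : A →ₗ[ℂ] A := contract (antiExt S hS) LinearMap.id ∘ₗ X
  change U (p * a) = S (S p) * U a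
  have hU : ∀ s t, antipodeMul S.toLinearMap (lmul Q (s ⊗ₜ t)) = S t * U s :=
    antipodeMul_lmul hS hA hX
  -- `S(t) S(h₁) h₂ s = ε(h) S(t) s`
  have hΔ : ∀ (h : A) (w : A ⊗[ℂ] A), antipodeMul S.toLinearMap (lmul (flip (Δ h)) w) =
      ε h • antipodeMul S.toLinearMap w := by
    intro h w
    induction w with
    | zero => simp
    | add x y hx hy => simp only [map_add, smul_add, hx, hy]
    | tmul s t =>
      have aux : ∀ z : A ⊗[ℂ] A, antipodeMul S.toLinearMap (TensorProduct.comm ℂ A A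
          ((LinearMap.mulRight ℂ t).rTensor A z)) =
            S t * LinearMap.mul' ℂ A (S.toLinearMap.rTensor A z) := by
        intro z
        induction z with
        | zero => simp
        | add x y hx hy => simp only [map_add, mul_add, hx, hy]
        | tmul p q => simp [hS, mul_assoc]
      rw [lmul_flip, TensorProduct.comm_tmul, lmul_Δ hA h1, aux, s1]
      simp [mul_smul_comm]
  have main : ∀ h t : A, antipodeMul S.toLinearMap (lmul Q
      ((LinearMap.mulRight ℂ a).rTensor A (T₁ (h ⊗ₜ t)))) = ε h • (S t * U a) := by
    intro h t
    rw [← lmul_Δ hA h1, ← lmul_mul, hQ, lmul_mul, hΔ, hU]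
  have main' : ∀ w : A ⊗[ℂ] A, antipodeMul S.toLinearMap (lmul Q
      ((LinearMap.mulRight ℂ a).rTensor A w)) =
        S (LinearMap.mul' ℂ A (S.toLinearMap.rTensor A w)) * U a := by
    intro w
    refine eq_of_comp_equiv T₁
      (antipodeMul S.toLinearMap ∘ₗ lmul Q ∘ₗ (LinearMap.mulRight ℂ a).rTensor A)
      (LinearMap.mulRight ℂ (U a) ∘ₗ S.toLinearMap ∘ₗ LinearMap.mul' ℂ A ∘ₗ
        S.toLinearMap.rTensor A) (fun h t => ?_) w
    simp only [LinearMap.comp_apply, main, s1]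
    simp
  refine hA.eq_of_mul_left fun q => ?_
  obtain ⟨q, rfl⟩ := S.surjective q
  have h := main' (p ⊗ₜ q)
  simp only [LinearMap.rTensor_tmul, LinearMap.mulRight_apply, hU] at h
  rw [h]
  simp [hS, mul_assoc]

lemma contract_mul_right (hA : Nondegenerate A) {Q : M (A ⊗[ℂ] A)} {X : A →ₗ[ℂ] A ⊗[ℂ] M A}
    (hX : ∀ a, emb (X a) = Q * tmulOne a) (f : M A →ₗ[ℂ] M A) (a b : A) :
    contract f LinearMap.id (X (a * b)) = contract f LinearMap.id (X a) * b := by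
  have h : X (a * b) = TensorProduct.map (LinearMap.mulRight ℂ b) LinearMap.id (X a) := by
    apply emb_injective hA
    rw [emb_map_mulRight, hX, hX, tmulOne_mul, mul_assoc]
  rw [h]
  generalize X a = x
  induction x with
  | zero => simp
  | add x y hx hy => simp only [map_add, add_mul, hx, hy]
  | tmul p m => simp [lmul_mul_right hA]

/-- If `Q Q' = 1` and `u = ∑ S(Q⁽²⁾) Q⁽¹⁾` satisfies `u p = S²(p) u`, then
`v = ∑ S⁻¹(Q'⁽²⁾) Q'⁽¹⁾` is a right inverse of `u`: `s ⊗ t ↦ S(t) s` maps `Q Q' (a ⊗ b)` to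
`∑ S(b) S(Q'⁽²⁾) u Q'⁽¹⁾ a = S(b) u v a`. -/
lemma contract_contract (hA : Nondegenerate A) {Q Q' : M (A ⊗[ℂ] A)} (hQ : Q * Q' = 1)
    {X Y : A →ₗ[ℂ] A ⊗[ℂ] M A} (hX : ∀ a, emb (X a) = Q * tmulOne a)
    (hY : ∀ a, emb (Y a) = Q' * tmulOne a)
    (hS' : ∀ x y, S.symm (x * y) = S.symm y * S.symm x)
    (hU : ∀ p a, contract (antiExt S hS) LinearMap.id (X (p * a)) =
      S (S p) * contract (antiExt S hS) LinearMap.id (X a)) (a : A) :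
    contract (antiExt S hS) LinearMap.id
      (X (contract (antiExt S.symm hS') LinearMap.id (Y a))) = a := by
  let U : A →ₗ[ℂ] A := contract (antiExt S hS) LinearMap.id ∘ₗ X
  change U _ = a
  have hUm : ∀ (m : M A) (b s : A),
      S b * U (lmul (antiExt S.symm hS' m) s) = S (lmul m b) * U s := by
    intro m b s
    obtain ⟨p, rfl⟩ := S.surjective b
    have h1 := hU p (lmul (antiExt S.symm hS' m) s)
    rw [mul_lmul, hU] at h1
    refine h1.symm.trans ?_
    simp [antiExt, U]
  refine hA.eq_of_mul_left fun b => ?_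
  obtain ⟨b, rfl⟩ := S.surjective b
  have h : antipodeMul S.toLinearMap (lmul Q (lmul Q' (a ⊗ₜ b))) = S b * a := by
    rw [← lmul_mul, hQ]
    simp
  rw [← h, lmul_tmul_of_emb hA (hY a)]
  generalize Y a = y
  induction y with
  | zero => simp
  | add x y hx hy => simp only [map_add, mul_add, hx, hy]
  | tmul s m =>
    rw [contract_tmul, LinearMap.lTensor_tmul, lmulAt_apply, antipodeMul_lmul hS hA hX]
    exact hUm m b s

/-- A bijection `U` of `A` with `U(a b) = U(a) b` and `U(a b) = S²(a) U(b)` is left multiplication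
by an invertible multiplier. -/
lemma exists_unit_lmul_eq (hA : Nondegenerate A) {U V : A →ₗ[ℂ] A} (hUV : ∀ a, U (V a) = a)
    (hVU : ∀ a, V (U a) = a) (hr : ∀ a b, U (a * b) = U a * b)
    (hl : ∀ a b, U (a * b) = S (S a) * U b) :
    ∃ u : (M A)ˣ, lmul (u : M A) = U ∧ lmul (↑u⁻¹ : M A) = V := by
  have hr' : ∀ a b, V (a * b) = V a * b := by
    intro a b
    rw [← hVU (V a * b), hr, hUV]
  have hl' : ∀ a b, V (S (S a) * b) = a * V b := by
    intro a b
    rw [← hVU (a * V b), hl, hUV]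
  let u : M A := mk U (U ∘ₗ S.symm.toLinearMap ∘ₗ S.symm.toLinearMap) fun a b => by
    simp [← hr, hl]
  let v : M A := mk V (V ∘ₗ S.toLinearMap ∘ₗ S.toLinearMap) fun a b => by
    simp [← hr', hl']
  exact ⟨⟨u, v, ext_lmul hA hUV, ext_lmul hA hVU⟩, rfl, rfl⟩

end Drinfeld

namespace RegularMultiplierHopfAlgebra

variable {A : Type*} [NonUnitalRing A] [Module ℂ A] [IsScalarTower ℂ A A] [SMulCommClass ℂ A A]
  {H : RegularMultiplierHopfAlgebra A}

lemma flip_flip (m : M (A ⊗[ℂ] A)) : flip (flip m) = m := by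
  have h : ∀ w : A ⊗[ℂ] A, TensorProduct.comm ℂ A A (TensorProduct.comm ℂ A A w) = w :=
    fun w => by simp
  exact ext_M (fun x => by simp [flip, transport, h]) (fun x => by simp [flip, transport, h])

/-- `S⁻¹(a₂) a₁ b = ε(a) b`. -/
lemma mul_antipode_symm_flip (H : RegularMultiplierHopfAlgebra A) {T₁ : A ⊗[ℂ] A ≃ₗ[ℂ] A ⊗[ℂ] A}
    (h1 : ∀ a b, inc (A ⊗[ℂ] A) (T₁ (a ⊗ₜ b)) = (flip ∘ₗ H.Δ) a * oneTmul b) (a b : A) :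
    LinearMap.mul' ℂ A (H.antipode.symm.toLinearMap.rTensor A (T₁ (a ⊗ₜ b))) =
      H.counit a • b := by
  have hA := H.nondegenerate
  obtain ⟨T, -, hT, -⟩ := H.isMultiplierHopf.2
  apply H.antipode.injective
  refine hA.eq_of_mul_right fun d => ?_
  have mix : (LinearMap.mulRight ℂ d).rTensor A (T₁ (a ⊗ₜ b)) =
      TensorProduct.comm ℂ A A ((LinearMap.mulRight ℂ b).rTensor A (T (a ⊗ₜ d))) := by
    rw [← lmul_Δ hA h1, ← lmul_Δ hA hT, LinearMap.comp_apply, lmul_flip,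
      TensorProduct.comm_tmul]
  have e1 : ∀ w : A ⊗[ℂ] A, H.antipode (LinearMap.mul' ℂ A
      (H.antipode.symm.toLinearMap.rTensor A w)) * d =
        antipodeMul H.antipode.toLinearMap (TensorProduct.comm ℂ A A
          (TensorProduct.comm ℂ A A ((LinearMap.mulRight ℂ d).rTensor A w))) := by
    intro w
    induction w with
    | zero => simp
    | add x y hx hy => simp only [map_add, add_mul, hx, hy]
    | tmul p q => simp [H.antipode_mul, mul_assoc]
  have e2 : ∀ w : A ⊗[ℂ] A, antipodeMul H.antipode.toLinearMap (TensorProduct.comm ℂ A A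
      ((LinearMap.mulRight ℂ b).rTensor A w)) =
        H.antipode b * LinearMap.mul' ℂ A (H.antipode.toLinearMap.rTensor A w) := by
    intro w
    induction w with
    | zero => simp
    | add x y hx hy => simp only [map_add, mul_add, hx, hy]
    | tmul p q => simp [H.antipode_mul, mul_assoc]
  have e3 : ∀ w : A ⊗[ℂ] A, TensorProduct.comm ℂ A A (TensorProduct.comm ℂ A A w) = w :=
    fun w => by simp
  have h := congrArg (antipodeMul H.antipode.toLinearMap) mix
  rw [e2, H.isAntipode.left a d _ (hT a d)] at h
  rw [e1, e3, h]
  simp [mul_smul_comm, smul_mul_assoc]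

end RegularMultiplierHopfAlgebra


namespace RegularMultiplierHopfAlgebra

variable {A : Type*} [NonUnitalRing A] [Module ℂ A] [IsScalarTower ℂ A A] [SMulCommClass ℂ A A]
  {H : RegularMultiplierHopfAlgebra A}

/-! ### The Drinfeld element of an R-matrix -/

lemma contract_map (f f' : M A →ₗ[ℂ] M A) (g g' : A →ₗ[ℂ] A) (x : A ⊗[ℂ] M A) :
    contract f g (TensorProduct.map g' f' x) = contract (f ∘ₗ f') (g ∘ₗ g') x := by
  induction x with
  | zero => simp
  | add x y hx hy => simp only [map_add, hx, hy]
  | tmul a m => simp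

/-- The multiplier `u = ∑ S(R⁽²⁾) R⁽¹⁾` is invertible. Its inverse is the same construction for the
co-opposite algebra, whose antipode is `S⁻¹` and which has `R⁻¹ = (ι ⊗ S⁻¹)(R)` as the element
intertwining the two comultiplications. -/
lemma IsRMatrix.exists_drinfeld [Nontrivial A] {R : (M (A ⊗[ℂ] A))ˣ}
    (hR : H.IsRMatrix (R : M (A ⊗[ℂ] A))) : ∃ u : (M A)ˣ,
      (∀ (a : A) (x : A ⊗[ℂ] M A), emb x = (R : M (A ⊗[ℂ] A)) * tmulOne a →
        lmul (u : M A) a = contract H.antipodeM LinearMap.id x) ∧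
      ∀ (a : A) (x : A ⊗[ℂ] M A), emb x = (R : M (A ⊗[ℂ] A)) * tmulOne a →
        lmul (↑u⁻¹ : M A) a = contract (H.antipodeInvM ∘ₗ H.antipodeInvM) LinearMap.id x := by
  have hA := H.nondegenerate
  obtain ⟨T, -, hT, -⟩ := H.isMultiplierHopf.2
  obtain ⟨T', -, hT', -⟩ := H.isMultiplierHopf_flip.2
  obtain ⟨X, hX⟩ := exists_linear_lift hA hR.mul_mem
  let Y : A →ₗ[ℂ] A ⊗[ℂ] M A := TensorProduct.map LinearMap.id H.antipodeInvM ∘ₗ X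
  have hY : ∀ a, emb (Y a) = (↑R⁻¹ : M (A ⊗[ℂ] A)) * tmulOne a :=
    fun a => (hR.inv_mul_tmulOne (hX a)).symm
  have hinv : ∀ h, (↑R⁻¹ : M (A ⊗[ℂ] A)) * (flip ∘ₗ H.Δ) h =
      flip ((flip ∘ₗ H.Δ) h) * (↑R⁻¹ : M (A ⊗[ℂ] A)) := by
    intro h
    rw [LinearMap.comp_apply, flip_flip, Units.inv_mul_eq_iff_eq_mul, ← mul_assoc,
      hR.mul_comul, mul_assoc, Units.mul_inv, mul_one]
  have hU := contract_mul_left H.antipode_mul hA hT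
    (fun a b => H.isAntipode.left a b _ (hT a b)) hR.mul_comul hX
  have hV := contract_mul_left H.antipode_symm_mul hA hT' (H.mul_antipode_symm_flip hT') hinv hY
  have hUV := contract_contract H.antipode_mul hA R.mul_inv hX hY H.antipode_symm_mul hU
  have hVU := contract_contract H.antipode_symm_mul hA R.inv_mul hY hX H.antipode_mul hV
  obtain ⟨u, hu, hu'⟩ := exists_unit_lmul_eq (S := H.antipode) hA
    (U := contract H.antipodeM LinearMap.id ∘ₗ X)
    (V := contract H.antipodeInvM LinearMap.id ∘ₗ Y) hUV hVU
    (contract_mul_right hA hX _) hU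
  refine ⟨u, fun a x hx => ?_, fun a x hx => ?_⟩
  · rw [hu, LinearMap.comp_apply, emb_injective hA (hx.trans (hX a).symm)]
  · rw [hu', LinearMap.comp_apply, LinearMap.comp_apply, contract_map,
      emb_injective hA (hx.trans (hX a).symm)]
    rfl

variable {R : (M (A ⊗[ℂ] A))ˣ}

/-- `∑ S⁻²(R⁽²⁾) R⁽¹⁾ = ∑ S⁻¹(R⁽²⁾) S(R⁽¹⁾)`. -/
lemma IsRMatrix.contract_eq_contract_antipode [Nontrivial A]
    (hR : H.IsRMatrix (R : M (A ⊗[ℂ] A))) {c : A} {x y : A ⊗[ℂ] M A}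
    (hx : emb x = (R : M (A ⊗[ℂ] A)) * tmulOne (H.antipode c))
    (hy : emb y = tmulOne c * (R : M (A ⊗[ℂ] A))) :
    contract (H.antipodeInvM ∘ₗ H.antipodeInvM) LinearMap.id x =
      contract H.antipodeInvM H.antipode.toLinearMap y := by
  have h := congrArg (contract H.antipodeInvM LinearMap.id) (hR.eq_map_antipode hx hy)
  rwa [contract_map, contract_map] at h

/-- `∑ S⁻¹(R⁽²⁾) S(R⁽¹⁾) = ∑ R⁽²⁾ S²(R⁽¹⁾)`. -/
lemma IsRMatrix.contract_antipode_eq_contract_sq [Nontrivial A]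
    (hR : H.IsRMatrix (R : M (A ⊗[ℂ] A))) {a : A} {x y : A ⊗[ℂ] M A}
    (hx : emb x = (R : M (A ⊗[ℂ] A)) * tmulOne a)
    (hy : emb y = tmulOne (H.antipode a) * (R : M (A ⊗[ℂ] A))) :
    contract H.antipodeInvM H.antipode.toLinearMap y =
      contract LinearMap.id (H.antipode.toLinearMap ∘ₗ H.antipode.toLinearMap) x := by
  have h := congrArg (contract LinearMap.id H.antipode.toLinearMap) (hR.eq_map_antipode' hx hy)
  rwa [contract_map, contract_map] at h

end RegularMultiplierHopfAlgebra

end MultHopf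

end

open MultHopf in
theorem lemma2p4 {A : Type*} [NonUnitalRing A] [Module ℂ A] [IsScalarTower ℂ A A]
    [SMulCommClass ℂ A A] (H : RegularMultiplierHopfAlgebra A) (R : (M (A ⊗[ℂ] A))ˣ)
    (hR : H.IsRMatrix R) :
    -- `(ε ⊗ ι)(R) = 1 = (ι ⊗ ε)(R)` in `M(A)`
    (Extends H.counitL R 1 ∧ Extends H.counitR R 1) ∧
    -- `R⁻¹(a ⊗ 1) = (ι ⊗ S⁻¹)(R(a ⊗ 1))`
    (∀ (a : A) (x : A ⊗[ℂ] M A), emb x = (R : M (A ⊗[ℂ] A)) * tmulOne a →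
      (↑R⁻¹ : M (A ⊗[ℂ] A)) * tmulOne a =
        emb (TensorProduct.map LinearMap.id H.antipodeInvM x)) ∧
    -- `(a ⊗ 1)R⁻¹ = (ι ⊗ S⁻¹)((a ⊗ 1)R)`
    (∀ (a : A) (x : A ⊗[ℂ] M A), emb x = tmulOne a * (R : M (A ⊗[ℂ] A)) →
      tmulOne a * (↑R⁻¹ : M (A ⊗[ℂ] A)) =
        emb (TensorProduct.map LinearMap.id H.antipodeInvM x)) ∧
    -- `R⁻¹(a ⊗ 1) = (S ⊗ ι)((S⁻¹(a) ⊗ 1)R)`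
    (∀ (a : A) (x : A ⊗[ℂ] M A), emb x = tmulOne (H.antipode.symm a) * (R : M (A ⊗[ℂ] A)) →
      (↑R⁻¹ : M (A ⊗[ℂ] A)) * tmulOne a =
        emb (TensorProduct.map H.antipode.toLinearMap LinearMap.id x)) ∧
    -- `(a ⊗ 1)R⁻¹ = (S ⊗ ι)(R(S⁻¹(a) ⊗ 1))`
    (∀ (a : A) (x : A ⊗[ℂ] M A), emb x = (R : M (A ⊗[ℂ] A)) * tmulOne (H.antipode.symm a) →
      tmulOne a * (↑R⁻¹ : M (A ⊗[ℂ] A)) =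
        emb (TensorProduct.map H.antipode.toLinearMap LinearMap.id x)) ∧
    -- `(S ⊗ S)(R) = R` in `M(A ⊗ A)`
    H.antipodeTensorM (R : M (A ⊗[ℂ] A)) = R ∧
    -- the multiplier `u` exists and is invertible in `M(A)`
    ∃ u : (M A)ˣ,
      -- `u a = ∑ S(R⁽²⁾) R⁽¹⁾ a`
      (∀ (a : A) (x : A ⊗[ℂ] M A), emb x = (R : M (A ⊗[ℂ] A)) * tmulOne a →
        lmul (u : M A) a = contract H.antipodeM LinearMap.id x) ∧
      -- `u⁻¹ a = ∑ S⁻²(R⁽²⁾) R⁽¹⁾ a`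
      (∀ (a : A) (x : A ⊗[ℂ] M A), emb x = (R : M (A ⊗[ℂ] A)) * tmulOne a →
        lmul (↑u⁻¹ : M A) a = contract (H.antipodeInvM ∘ₗ H.antipodeInvM) LinearMap.id x) ∧
      -- `u⁻¹ a = ∑ S⁻¹(R⁽²⁾) S(R⁽¹⁾) a`, where `S(R⁽¹⁾) a = S(S⁻¹(a) R⁽¹⁾)`
      (∀ (a : A) (x : A ⊗[ℂ] M A), emb x = tmulOne (H.antipode.symm a) * (R : M (A ⊗[ℂ] A)) →
        lmul (↑u⁻¹ : M A) a = contract H.antipodeInvM H.antipode.toLinearMap x) ∧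
      -- `u⁻¹ a = ∑ R⁽²⁾ S²(R⁽¹⁾) a`, where `S²(R⁽¹⁾) a = S²(R⁽¹⁾ S⁻²(a))`
      (∀ (a : A) (x : A ⊗[ℂ] M A),
        emb x = (R : M (A ⊗[ℂ] A)) * tmulOne (H.antipode.symm (H.antipode.symm a)) →
        lmul (↑u⁻¹ : M A) a = contract LinearMap.id
          (H.antipode.toLinearMap ∘ₗ H.antipode.toLinearMap) x) := by
  rcases subsingleton_or_nontrivial A with hs | hn
  · have : Subsingleton (A ⊗[ℂ] A) := ⟨fun x y => by
      have h : ∀ z : A ⊗[ℂ] A, z = 0 := fun z => by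
        induction z with
        | zero => rfl
        | add x y hx hy => rw [hx, hy, add_zero]
        | tmul a b => rw [Subsingleton.elim a 0, TensorProduct.zero_tmul]
      rw [h x, h y]⟩
    have : Subsingleton (M A) :=
      ⟨fun m n => ext_M (fun _ => Subsingleton.elim _ _) (fun _ => Subsingleton.elim _ _)⟩
    have : Subsingleton (M (A ⊗[ℂ] A)) :=
      ⟨fun m n => ext_M (fun _ => Subsingleton.elim _ _) (fun _ => Subsingleton.elim _ _)⟩
    exact ⟨⟨fun _ => ⟨Subsingleton.elim _ _, Subsingleton.elim _ _⟩,
        fun _ => ⟨Subsingleton.elim _ _, Subsingleton.elim _ _⟩⟩,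
      fun _ _ _ => Subsingleton.elim _ _, fun _ _ _ => Subsingleton.elim _ _,
      fun _ _ _ => Subsingleton.elim _ _, fun _ _ _ => Subsingleton.elim _ _,
      Subsingleton.elim _ _, 1, fun _ _ _ => Subsingleton.elim _ _,
      fun _ _ _ => Subsingleton.elim _ _, fun _ _ _ => Subsingleton.elim _ _,
      fun _ _ _ => Subsingleton.elim _ _⟩
  · have hS : ∀ a, H.antipode (H.antipode.symm a) = a := H.antipode.apply_symm_apply
    obtain ⟨u, hu, hu'⟩ := hR.exists_drinfeld
    have hu2 : ∀ (a : A) (y : A ⊗[ℂ] M A),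
        emb y = tmulOne (H.antipode.symm a) * (R : M (A ⊗[ℂ] A)) →
        lmul (↑u⁻¹ : M A) a = contract H.antipodeInvM H.antipode.toLinearMap y := by
      intro a y hy
      obtain ⟨x, hx⟩ := hR.mul_mem a
      rw [hu' a x hx, hR.contract_eq_contract_antipode (by rwa [hS]) hy]
    refine ⟨⟨hR.extends_counitL, hR.extends_counitR⟩, fun a x hx => hR.inv_mul_tmulOne hx,
      fun a x hx => hR.tmulOne_mul_inv hx, fun a x hx => ?_, fun a x hx => ?_,
      hR.antipodeTensorM_eq, u, hu, hu', hu2, fun a x hx => ?_⟩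
    · rw [← hR.inv_mul_tmulOne_antipode hx, hS]
    · rw [← hR.tmulOne_antipode_mul_inv hx, hS]
    · obtain ⟨y, hy⟩ := hR.mem_mul (H.antipode.symm a)
      rw [hu2 a y hy, hR.contract_antipode_eq_contract_sq hx (by rwa [hS])]
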